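/- **Setting.** All tensor products of C\*-algebras are minimal. A compact quantum group $G$ is a nonzero unital C\*-algebra $A=C(G)$ with a unital $*$-homomorphism $\Delta:A\to A\otimes A$ such that $(\Delta\otimes \mathrm{id})\Delta=(\mathrm{id}\otimes\Delta)\Delta$ and the linear spans of $\Delta(A)(1\otimes A)$ and $\Delta(A)(A\otimes 1)$ are dense in $A\otimes A$. A (unital) $*$-homomorphism $\varphi:C(G)\to C(H)$ is a morphism if $(\varphi\otimes\varphi)\Delta_G=\Delta_H\varphi$; $G$ and $H$ are isomorphic if there is a $*$-isomorphism which is a morphism. A quantum subgroup of $G$ is a compact quantum group $H$ with a surjective morphism $\pi_H:C(G)\to C(H)$ (equivalently, a quotient of $C(G)$ by a proper Woronowicz C\*-ideal). An action of $G$ on a compact Hausdorff space $X$ is a unital $*$-homomorphism $\alpha:C(X)\to C(X)\otimes C(G)$ with $(\alpha\otimes \mathrm{id})\alpha=(\mathrm{id}\otimes\Delta)\alpha$ such that the linear span of $\alpha(C(X))(1\otimes C(G))$ is dense. A quantum subgroup $H$ of $G$ fixes $Y\subseteq X$ if $(\mathrm{ev}_y\otimes\pi_H)\alpha(f)=f(y)1$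 for all $f\in C(X)$ and $y\in Y$. It is a stabilizer of $Y$ if it fixes $Y$ and if for every quantum subgroup $K$ of $G$ fixing $Y$ there is a surjective morphism $\theta:C(H)\to C(K)$ with $\theta\pi_H=\pi_K$. For $n\ge 0$ the quantum permutation group $A_s(n)$ is the universal unital C\*-algebra generated by elements $a_{ij}$, $1\le i,j\le n$, with $a_{ij}=a_{ij}^*=a_{ij}^2$, $\sum_j a_{ij}=1$ for all $i$ and $\sum_i a_{ij}=1$ for all $j$, equipped with $\Delta(a_{ij})=\sum_k a_{ik}\otimes a_{kj}$ (so $A_s(0)=\mathbb C$). **Theorem.** Let $n\geq 1$, let $X_n=\{x_1,\dots,x_n\}$ be the $n$-point set, let $e_i\in C(X_n)$ be the indicator function of $x_i$, and let $A_s(n)$ act on $X_n$ by the action $\alpha$ with $$\alpha(e_i)=\sum_{j=1}^n e_j\otimes a_{ji}\qquad(1\le i\le n).$$ Then for every $x\in X_n$ the stabilizer of $\{x\}$ exists, and every stabilizer of $\{x\}$ is isomorphic, as a compact quantum group, to $A_s(n-1)$. -/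

import Mathlib

noncomputable section

open scoped TensorProduct

universe u v w

/-! ### C*-seminorms and their completions -/

/-- A C*-seminorm on a unital complex *-algebra. -/
structure CStarSeminorm (A : Type u) [Ring A] [StarRing A] [Algebra ℂ A] where
  toFun : A → ℝ
  map_zero' : toFun 0 = 0
  add_le' : ∀ a b, toFun (a + b) ≤ toFun a + toFun b
  neg' : ∀ a, toFun (-a) = toFun a
  smul_le' : ∀ (c : ℂ) a, toFun (c • a) ≤ ‖c‖ * toFun a
  mul_le' : ∀ a b, toFun (a * b) ≤ toFun a * toFun b
  star' : ∀ a, toFun (star a) = toFun a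
  cstar' : ∀ a, toFun a * toFun a ≤ toFun (star a * a)

set_option linter.unusedSectionVars false

namespace CStarSeminorm

variable {A : Type u} [Ring A] [StarRing A] [Algebra ℂ A] [StarModule ℂ A]

/-- The supremum of the C*-seminorms `a ↦ ‖φ i a‖` over a family of *-homomorphisms into
C*-algebras which is bounded at every element. -/
def ofFamily {ι : Type v} (D : ι → Type w) [∀ i, CStarAlgebra (D i)]
    (φ : ∀ i, A →⋆ₐ[ℂ] D i) (bdd : ∀ a, BddAbove (Set.range fun i => ‖φ i a‖)) :
    CStarSeminorm A where
  toFun a := ⨆ i, ‖φ i a‖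
  map_zero' := by simp
  add_le' a b := by
    refine Real.iSup_le (fun i => ?_) (add_nonneg (Real.iSup_nonneg fun _ => norm_nonneg _)
      (Real.iSup_nonneg fun _ => norm_nonneg _))
    rw [map_add]
    exact (norm_add_le _ _).trans (add_le_add (le_ciSup (bdd a) i) (le_ciSup (bdd b) i))
  neg' a := by simp
  smul_le' c a := by
    refine Real.iSup_le (fun i => ?_) (mul_nonneg (norm_nonneg _)
      (Real.iSup_nonneg fun _ => norm_nonneg _))
    rw [map_smul, norm_smul]
    exact mul_le_mul_of_nonneg_left (le_ciSup (bdd a) i) (norm_nonneg _)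
  mul_le' a b := by
    refine Real.iSup_le (fun i => ?_) (mul_nonneg (Real.iSup_nonneg fun _ => norm_nonneg _)
      (Real.iSup_nonneg fun _ => norm_nonneg _))
    rw [map_mul]
    exact (norm_mul_le _ _).trans (mul_le_mul (le_ciSup (bdd a) i) (le_ciSup (bdd b) i)
      (norm_nonneg _) (Real.iSup_nonneg fun _ => norm_nonneg _))
  star' a := by simp [map_star]
  cstar' a := by
    rw [Real.iSup_mul_of_nonneg (Real.iSup_nonneg fun _ => norm_nonneg _)]
    refine Real.iSup_le (fun i => ?_) (Real.iSup_nonneg fun _ => norm_nonneg _)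
    rw [Real.mul_iSup_of_nonneg (norm_nonneg _)]
    refine Real.iSup_le (fun j => ?_) (Real.iSup_nonneg fun _ => norm_nonneg _)
    have key : ∀ k, ‖φ k a‖ * ‖φ k a‖ ≤ ⨆ i, ‖φ i (star a * a)‖ := fun k => by
      have := le_ciSup (bdd (star a * a)) k
      rwa [map_mul, map_star, CStarRing.norm_star_mul_self] at this
    rcases le_total ‖φ i a‖ ‖φ j a‖ with h | h
    · exact (mul_le_mul_of_nonneg_right h (norm_nonneg _)).trans (key j)
    · exact (mul_le_mul_of_nonneg_left h (norm_nonneg _)).trans (key i)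

lemma le_ofFamily {ι : Type v} (D : ι → Type w) [∀ i, CStarAlgebra (D i)]
    (φ : ∀ i, A →⋆ₐ[ℂ] D i) (bdd : ∀ a, BddAbove (Set.range fun i => ‖φ i a‖)) (i : ι) (a : A) :
    ‖φ i a‖ ≤ (ofFamily D φ bdd).toFun a := le_ciSup (bdd a) i

variable (p : CStarSeminorm A)

/-- The *-algebra `A`, seen as a seminormed algebra with respect to `p`. -/
def Space (_p : CStarSeminorm A) : Type u := A

instance : Ring p.Space := inferInstanceAs (Ring A)
instance : StarRing p.Space := inferInstanceAs (StarRing A)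
instance : Algebra ℂ p.Space := inferInstanceAs (Algebra ℂ A)
instance : StarModule ℂ p.Space := inferInstanceAs (StarModule ℂ A)

instance : SeminormedRing p.Space where
  __ := (inferInstance : Ring p.Space)
  __ := AddGroupSeminorm.toSeminormedAddCommGroup (E := p.Space)
    { toFun := p.toFun
      map_zero' := p.map_zero'
      add_le' := p.add_le'
      neg' := p.neg' }
  norm_mul_le := p.mul_le'

instance : NormedSpace ℂ p.Space where
  norm_smul_le := p.smul_le'

lemma norm_star_space (a : p.Space) : ‖star a‖ = ‖a‖ := p.star' a

/-- The C*-algebra obtained from `A` by separation and completion with respect to `p`. -/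
abbrev Completion : Type u := UniformSpace.Completion p.Space

instance : NormedAlgebra ℂ p.Completion where
  norm_smul_le c x := norm_smul_le c x

def coeFun (a : A) : p.Completion := ((show p.Space from a : p.Space) : UniformSpace.Completion p.Space)

lemma norm_coeFun (a : A) : ‖p.coeFun a‖ = p.toFun a :=
  UniformSpace.Completion.norm_coe (E := p.Space) a

lemma induction {P : p.Completion → Prop} (x : p.Completion) (hc : IsClosed {x | P x})
    (h : ∀ a, P (p.coeFun a)) : P x :=
  UniformSpace.Completion.induction_on (α := p.Space) x hc h

lemma induction₂ {P : p.Completion → p.Completion → Prop} (x y : p.Completion)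
    (hc : IsClosed {x : p.Completion × p.Completion | P x.1 x.2})
    (h : ∀ a b, P (p.coeFun a) (p.coeFun b)) : P x y :=
  UniformSpace.Completion.induction_on₂ (α := p.Space) (β := p.Space) x y hc h

lemma coeFun_add (a b : A) : p.coeFun (a + b) = p.coeFun a + p.coeFun b :=
  UniformSpace.Completion.coe_add (α := p.Space) a b
lemma coeFun_mul (a b : A) : p.coeFun (a * b) = p.coeFun a * p.coeFun b :=
  UniformSpace.Completion.coe_mul (α := p.Space) a b
lemma coeFun_smul (c : ℂ) (a : A) : p.coeFun (c • a) = c • p.coeFun a :=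
  UniformSpace.Completion.coe_smul (X := p.Space) c a

lemma uniformContinuous_star_space : UniformContinuous (star : p.Space → p.Space) := by
  have : Isometry (star : p.Space → p.Space) :=
    AddMonoidHomClass.isometry_of_norm (starAddEquiv : p.Space ≃+ p.Space) p.norm_star_space
  exact this.uniformContinuous

instance : Star p.Completion where
  star := UniformSpace.Completion.map (star : p.Space → p.Space)

lemma star_coeFun (a : A) : star (p.coeFun a) = p.coeFun (star a) :=
  UniformSpace.Completion.map_coe p.uniformContinuous_star_space _

lemma continuous_star' : Continuous (star : p.Completion → p.Completion) :=
  UniformSpace.Completion.continuous_map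

instance : StarRing p.Completion where
  star_involutive x := by
    refine p.induction (P := fun y => star (star y) = y) x
      (isClosed_eq (p.continuous_star'.comp p.continuous_star') continuous_id) fun a => ?_
    rw [star_coeFun, star_coeFun, star_star]
  star_mul x y := by
    refine p.induction₂ (P := fun x y => star (x * y) = star y * star x) x y
      (isClosed_eq (p.continuous_star'.comp continuous_mul)
        ((p.continuous_star'.comp continuous_snd).mul (p.continuous_star'.comp continuous_fst)))
      fun a b => ?_
    rw [← coeFun_mul, star_coeFun, star_coeFun, star_coeFun, ← coeFun_mul, star_mul]
  star_add x y := by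
    refine p.induction₂ (P := fun x y => star (x + y) = star x + star y) x y
      (isClosed_eq (p.continuous_star'.comp continuous_add)
        ((p.continuous_star'.comp continuous_fst).add (p.continuous_star'.comp continuous_snd)))
      fun a b => ?_
    rw [← coeFun_add, star_coeFun, star_coeFun, star_coeFun, ← coeFun_add, star_add]

instance : StarModule ℂ p.Completion where
  star_smul c x := by
    refine p.induction (P := fun y => star (c • y) = star c • star y) x
      (isClosed_eq (p.continuous_star'.comp (continuous_const_smul c))
        ((continuous_const_smul (star c)).comp p.continuous_star')) fun a => ?_
    rw [← coeFun_smul, star_coeFun, star_coeFun, ← coeFun_smul, star_smul]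

instance : CStarRing p.Completion where
  norm_mul_self_le x := by
    refine p.induction x (isClosed_le (f := fun y : p.Completion => ‖y‖ * ‖y‖)
      (g := fun y : p.Completion => ‖star y * y‖) (continuous_norm.mul continuous_norm)
      (continuous_norm.comp (p.continuous_star'.mul continuous_id))) fun a => ?_
    rw [star_coeFun, ← coeFun_mul, norm_coeFun, norm_coeFun]
    exact p.cstar' a

instance : CStarAlgebra p.Completion where

/-- The canonical *-homomorphism from `A` to its completion. -/
def toCompletion : A →⋆ₐ[ℂ] p.Completion where
  toFun := p.coeFun
  map_one' := UniformSpace.Completion.coe_one p.Space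
  map_mul' := p.coeFun_mul
  map_zero' := UniformSpace.Completion.coe_zero (α := p.Space)
  map_add' := p.coeFun_add
  commutes' c := by
    rw [Algebra.algebraMap_eq_smul_one, coeFun_smul, Algebra.algebraMap_eq_smul_one]
    congr 1
  map_star' a := (p.star_coeFun a).symm

lemma norm_toCompletion (a : A) : ‖p.toCompletion a‖ = p.toFun a := p.norm_coeFun a

lemma denseRange_toCompletion : DenseRange p.toCompletion :=
  UniformSpace.Completion.denseRange_coe (α := p.Space)

variable {B : Type v} [CStarAlgebra B]

lemma continuous_of_le (φ : A →⋆ₐ[ℂ] B) (h : ∀ a, ‖φ a‖ ≤ p.toFun a) :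
    Continuous (show p.Space → B from φ) :=
  AddMonoidHomClass.continuous_of_bound (E := p.Space)
    (show p.Space →+ B from (φ : A →+ B)) 1 fun a => by rw [one_mul]; exact h a

/-- A *-homomorphism dominated by `p` extends to the completion. -/
def lift (φ : A →⋆ₐ[ℂ] B) (h : ∀ a, ‖φ a‖ ≤ p.toFun a) : p.Completion →⋆ₐ[ℂ] B where
  toRingHom := UniformSpace.Completion.extensionHom (α := p.Space)
    (show p.Space →+* B from (φ : A →+* B)) (p.continuous_of_le φ h)
  commutes' c := by
    have : algebraMap ℂ p.Completion c = p.coeFun (algebraMap ℂ A c) :=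
      (p.toCompletion.toAlgHom.commutes c).symm
    rw [this]
    exact (UniformSpace.Completion.extensionHom_coe (α := p.Space)
      (show p.Space →+* B from (φ : A →+* B)) (p.continuous_of_le φ h) _).trans
      (φ.toAlgHom.commutes c)
  map_star' x := by
    have key : ∀ a, UniformSpace.Completion.extensionHom (α := p.Space)
        (show p.Space →+* B from (φ : A →+* B)) (p.continuous_of_le φ h) (p.coeFun a) = φ a :=
      UniformSpace.Completion.extensionHom_coe (α := p.Space)
        (show p.Space →+* B from (φ : A →+* B)) (p.continuous_of_le φ h)
    have hc : Continuous (UniformSpace.Completion.extensionHom (α := p.Space)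
        (show p.Space →+* B from (φ : A →+* B)) (p.continuous_of_le φ h)) :=
      UniformSpace.Completion.continuous_extension
    refine p.induction (P := fun y => UniformSpace.Completion.extensionHom (α := p.Space)
        (show p.Space →+* B from (φ : A →+* B)) (p.continuous_of_le φ h) (star y) =
        star (UniformSpace.Completion.extensionHom (α := p.Space)
        (show p.Space →+* B from (φ : A →+* B)) (p.continuous_of_le φ h) y)) x
      (isClosed_eq (hc.comp p.continuous_star') (hc.star)) fun a => ?_
    rw [star_coeFun, key, key, map_star]

@[simp] lemma lift_toCompletion (φ : A →⋆ₐ[ℂ] B) (h : ∀ a, ‖φ a‖ ≤ p.toFun a) (a : A) :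
    p.lift φ h (p.toCompletion a) = φ a :=
  UniformSpace.Completion.extensionHom_coe (α := p.Space)
    (show p.Space →+* B from (φ : A →+* B)) (p.continuous_of_le φ h) a

lemma starHom_continuous {A B : Type*} [CStarAlgebra A] [CStarAlgebra B] (φ : A →⋆ₐ[ℂ] B) :
    Continuous φ :=
  AddMonoidHomClass.continuous_of_bound φ 1
    fun a => by rw [one_mul]; exact NonUnitalStarAlgHom.norm_apply_le φ a

lemma hom_ext {φ ψ : p.Completion →⋆ₐ[ℂ] B}
    (h : ∀ a, φ (p.toCompletion a) = ψ (p.toCompletion a)) : φ = ψ := by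
  ext x
  exact p.induction x (isClosed_eq (starHom_continuous φ) (starHom_continuous ψ)) h

end CStarSeminorm

/-! ### The minimal (spatial) tensor product of C*-algebras -/

/-- The Hilbert space tensor product. -/
def HilbertTensor (H K : Type u) [NormedAddCommGroup H] [InnerProductSpace ℂ H]
    [NormedAddCommGroup K] [InnerProductSpace ℂ K] : Type u :=
  UniformSpace.Completion (H ⊗[ℂ] K)

section HilbertTensorInstances

variable (H K : Type u) [NormedAddCommGroup H] [InnerProductSpace ℂ H]
  [NormedAddCommGroup K] [InnerProductSpace ℂ K]

instance : NormedAddCommGroup (HilbertTensor H K) :=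
  inferInstanceAs (NormedAddCommGroup (UniformSpace.Completion (H ⊗[ℂ] K)))
instance : InnerProductSpace ℂ (HilbertTensor H K) :=
  inferInstanceAs (InnerProductSpace ℂ (UniformSpace.Completion (H ⊗[ℂ] K)))
instance : CompleteSpace (HilbertTensor H K) :=
  inferInstanceAs (CompleteSpace (UniformSpace.Completion (H ⊗[ℂ] K)))

end HilbertTensorInstances

section HilbertTensor

variable {H K : Type u} [NormedAddCommGroup H] [InnerProductSpace ℂ H] [CompleteSpace H]
  [NormedAddCommGroup K] [InnerProductSpace ℂ K] [CompleteSpace K]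

namespace HilbertTensor

/-- The canonical isometric embedding of the algebraic tensor product. -/
def ofAlg : H ⊗[ℂ] K →ₗᵢ[ℂ] HilbertTensor H K :=
  UniformSpace.Completion.toComplₗᵢ (𝕜 := ℂ) (E := H ⊗[ℂ] K)

lemma denseRange_ofAlg : DenseRange (ofAlg : H ⊗[ℂ] K →ₗᵢ[ℂ] HilbertTensor H K) :=
  UniformSpace.Completion.denseRange_coe (α := H ⊗[ℂ] K)

/-- The elementary tensor `ξ ⊗ η` in the Hilbert space tensor product. -/
def tmul (ξ : H) (η : K) : HilbertTensor H K := ofAlg (ξ ⊗ₜ[ℂ] η)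

/-- The bounded operator `S ⊗ T` on the Hilbert space tensor product. -/
def op (S : H →L[ℂ] H) (T : K →L[ℂ] K) : HilbertTensor H K →L[ℂ] HilbertTensor H K :=
  ContinuousLinearMap.completion (R₁ := ℂ) (R₂ := ℂ) (α := H ⊗[ℂ] K) (β := H ⊗[ℂ] K)
    (TensorProduct.mapL S T)

lemma op_ofAlg (S : H →L[ℂ] H) (T : K →L[ℂ] K) (x : H ⊗[ℂ] K) :
    op S T (ofAlg x) = ofAlg (TensorProduct.mapL S T x) :=
  ContinuousLinearMap.completion_apply_coe _ _

lemma op_tmul (S : H →L[ℂ] H) (T : K →L[ℂ] K) (ξ : H) (η : K) :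
    op S T (tmul ξ η) = tmul (S ξ) (T η) := by
  rw [tmul, op_ofAlg]; rfl

lemma inner_tmul (ξ ξ' : H) (η η' : K) :
    inner ℂ (tmul ξ η) (tmul ξ' η') = inner ℂ ξ ξ' * inner ℂ η η' := by
  rw [tmul, tmul, LinearIsometry.inner_map_map, TensorProduct.inner_tmul]

lemma ext_ofAlg {S T : HilbertTensor H K →L[ℂ] HilbertTensor H K}
    (h : ∀ x : H ⊗[ℂ] K, S (ofAlg x) = T (ofAlg x)) : S = T := by
  ext x
  exact congrFun (denseRange_ofAlg.equalizer S.continuous T.continuous (funext h)) x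

/-- The bilinear map `(S, T) ↦ S ⊗ T`. -/
def opBilin : (H →L[ℂ] H) →ₗ[ℂ] (K →L[ℂ] K) →ₗ[ℂ]
    (HilbertTensor H K →L[ℂ] HilbertTensor H K) :=
  LinearMap.mk₂ ℂ op
    (fun S S' T => ext_ofAlg fun x => by
      simp [op_ofAlg, TensorProduct.mapL_add_left])
    (fun c S T => ext_ofAlg fun x => by
      simp [op_ofAlg, TensorProduct.mapL_smul_left])
    (fun S T T' => ext_ofAlg fun x => by
      simp [op_ofAlg, TensorProduct.mapL_add_right])
    (fun c S T => ext_ofAlg fun x => by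
      simp [op_ofAlg, TensorProduct.mapL_smul_right])

lemma op_mul (S S' : H →L[ℂ] H) (T T' : K →L[ℂ] K) : op (S * S') (T * T') = op S T * op S' T' :=
  ext_ofAlg fun x => by simp [op_ofAlg, TensorProduct.mapL_mul]

lemma op_one : op (1 : H →L[ℂ] H) (1 : K →L[ℂ] K) = 1 :=
  ext_ofAlg fun x => by
    have : TensorProduct.mapL (1 : H →L[ℂ] H) (1 : K →L[ℂ] K) = .id ℂ _ :=
      TensorProduct.mapL_id_id
    rw [op_ofAlg, this]; rfl

lemma op_star (S : H →L[ℂ] H) (T : K →L[ℂ] K) : op (star S) (star T) = star (op S T) := by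
  rw [ContinuousLinearMap.star_eq_adjoint (op S T), ContinuousLinearMap.eq_adjoint_iff]
  intro x y
  refine denseRange_ofAlg.induction_on₂ (p := fun x y =>
    inner ℂ (op (star S) (star T) x) y = inner ℂ x (op S T y))
    (isClosed_eq (by fun_prop) (by fun_prop)) ?_ x y
  intro x y
  rw [op_ofAlg, op_ofAlg, LinearIsometry.inner_map_map, LinearIsometry.inner_map_map]
  induction x with
  | zero => simp
  | add x x' hx hx' => simp only [map_add, inner_add_left, hx, hx']
  | tmul a b =>
    induction y with
    | zero => simp
    | add y y' hy hy' => simp only [map_add, inner_add_right, hy, hy']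
    | tmul c d =>
      simp [ContinuousLinearMap.star_eq_adjoint, ContinuousLinearMap.adjoint_inner_left]

lemma norm_op_le (S : H →L[ℂ] H) (T : K →L[ℂ] K) : ‖op S T‖ ≤ ‖S‖ * ‖T‖ := by
  refine ContinuousLinearMap.opNorm_le_bound _ (by positivity) fun x => ?_
  refine denseRange_ofAlg.induction_on (p := fun x => ‖op S T x‖ ≤ ‖S‖ * ‖T‖ * ‖x‖) x
    (isClosed_le (by fun_prop) (by fun_prop)) fun x => ?_
  rw [op_ofAlg, LinearIsometry.norm_map, LinearIsometry.norm_map]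
  exact (ContinuousLinearMap.le_opNorm _ _).trans
    (mul_le_mul_of_nonneg_right (TensorProduct.norm_mapL_le _ _) (norm_nonneg _))

end HilbertTensor

variable {A B : Type u} [CStarAlgebra A] [CStarAlgebra B]

/-- The representation `π ⊗ ρ` of the algebraic tensor product of two C*-algebras on the
Hilbert space tensor product. -/
def algTensorRep (π : A →⋆ₐ[ℂ] (H →L[ℂ] H)) (ρ : B →⋆ₐ[ℂ] (K →L[ℂ] K)) :
    A ⊗[ℂ] B →⋆ₐ[ℂ] (HilbertTensor H K →L[ℂ] HilbertTensor H K) where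
  toAlgHom := Algebra.TensorProduct.algHomOfLinearMapTensorProduct
    (TensorProduct.lift (HilbertTensor.opBilin.compl₁₂ π.toAlgHom.toLinearMap
      ρ.toAlgHom.toLinearMap))
    (fun a a' b b' => by
      change HilbertTensor.op (π (a * a')) (ρ (b * b')) = _
      rw [map_mul, map_mul, HilbertTensor.op_mul]; rfl)
    (by
      change HilbertTensor.op (π 1) (ρ 1) = _
      rw [map_one, map_one, HilbertTensor.op_one])
  map_star' x := by
    induction x with
    | zero => simp
    | add x y hx hy => simp only [star_add, AlgHom.toRingHom_eq_coe] at *; simp_all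
    | tmul a b =>
      change HilbertTensor.op (π (star a)) (ρ (star b)) = star (HilbertTensor.op (π a) (ρ b))
      rw [map_star, map_star, HilbertTensor.op_star]

lemma algTensorRep_tmul (π : A →⋆ₐ[ℂ] (H →L[ℂ] H)) (ρ : B →⋆ₐ[ℂ] (K →L[ℂ] K)) (a : A) (b : B) :
    algTensorRep π ρ (a ⊗ₜ b) = HilbertTensor.op (π a) (ρ b) := rfl

end HilbertTensor

/-- A pair of representations of the C*-algebras `A` and `B` on Hilbert spaces. -/
structure RepPair (A B : Type u) [CStarAlgebra A] [CStarAlgebra B] where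
  {H : Type u}
  {K : Type u}
  [h₁ : NormedAddCommGroup H]
  [h₂ : InnerProductSpace ℂ H]
  [h₃ : CompleteSpace H]
  [k₁ : NormedAddCommGroup K]
  [k₂ : InnerProductSpace ℂ K]
  [k₃ : CompleteSpace K]
  π : A →⋆ₐ[ℂ] (H →L[ℂ] H)
  ρ : B →⋆ₐ[ℂ] (K →L[ℂ] K)

attribute [instance] RepPair.h₁ RepPair.h₂ RepPair.h₃ RepPair.k₁ RepPair.k₂ RepPair.k₃

section MinTensor

variable (A B : Type u) [CStarAlgebra A] [CStarAlgebra B]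

lemma bddAbove_repPair (x : A ⊗[ℂ] B) :
    BddAbove (Set.range fun i : RepPair A B => ‖algTensorRep i.π i.ρ x‖) := by
  suffices h : ∃ C, ∀ i : RepPair A B, ‖algTensorRep i.π i.ρ x‖ ≤ C by
    obtain ⟨C, hC⟩ := h
    exact ⟨C, by rintro _ ⟨i, rfl⟩; exact hC i⟩
  induction x with
  | zero => exact ⟨0, fun i => by simp⟩
  | add x y hx hy =>
    obtain ⟨C, hC⟩ := hx
    obtain ⟨D, hD⟩ := hy
    exact ⟨C + D, fun i => by rw [map_add]; exact (norm_add_le _ _).trans (add_le_add (hC i) (hD i))⟩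
  | tmul a b =>
    refine ⟨‖a‖ * ‖b‖, fun i => ?_⟩
    rw [algTensorRep_tmul]
    exact (HilbertTensor.norm_op_le _ _).trans (mul_le_mul (NonUnitalStarAlgHom.norm_apply_le _ _)
      (NonUnitalStarAlgHom.norm_apply_le _ _) (norm_nonneg _) (norm_nonneg _))

/-- The minimal C*-norm `‖x‖ = sup ‖(π ⊗ ρ)(x)‖` on the algebraic tensor product, the supremum
being over all representations `π` of `A` and `ρ` of `B` on Hilbert spaces. -/
def minTensorNorm : CStarSeminorm (A ⊗[ℂ] B) :=
  CStarSeminorm.ofFamily (fun i : RepPair A B => (HilbertTensor i.H i.K →L[ℂ] HilbertTensor i.H i.K))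
    (fun i => algTensorRep i.π i.ρ) (bddAbove_repPair A B)

/-- The minimal tensor product of two unital C*-algebras. -/
def MinTensor : Type u := (minTensorNorm A B).Completion

instance : CStarAlgebra (MinTensor A B) := inferInstanceAs (CStarAlgebra (minTensorNorm A B).Completion)

namespace MinTensor

variable {A B}

/-- The canonical map from the algebraic to the minimal tensor product. -/
def ofAlg : A ⊗[ℂ] B →⋆ₐ[ℂ] MinTensor A B := (minTensorNorm A B).toCompletion

/-- The elementary tensor `a ⊗ b`. -/
def tmul (a : A) (b : B) : MinTensor A B := ofAlg (a ⊗ₜ b)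

lemma denseRange_ofAlg : DenseRange (ofAlg : A ⊗[ℂ] B →⋆ₐ[ℂ] MinTensor A B) :=
  (minTensorNorm A B).denseRange_toCompletion

lemma tmul_mul_tmul (a a' : A) (b b' : B) :
    tmul a b * tmul a' b' = tmul (a * a') (b * b') := by
  simp [tmul, ← map_mul]

lemma star_tmul (a : A) (b : B) : star (tmul a b) = tmul (star a) (star b) := by
  simp [tmul, ← map_star]

lemma tmul_one_one : tmul (1 : A) (1 : B) = 1 := by
  rw [tmul, ← Algebra.TensorProduct.one_def, map_one]

lemma tmul_sum {ι : Type*} (s : Finset ι) (a : A) (b : ι → B) :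
    tmul a (∑ i ∈ s, b i) = ∑ i ∈ s, tmul a (b i) := by
  simp [tmul, TensorProduct.tmul_sum, map_sum]

lemma sum_tmul {ι : Type*} (s : Finset ι) (a : ι → A) (b : B) :
    tmul (∑ i ∈ s, a i) b = ∑ i ∈ s, tmul (a i) b := by
  simp [tmul, TensorProduct.sum_tmul, map_sum]

lemma smul_tmul (c : ℂ) (a : A) (b : B) : tmul (c • a) b = c • tmul a b := by
  simp [tmul, ← TensorProduct.smul_tmul', map_smul]

lemma tmul_smul (c : ℂ) (a : A) (b : B) : tmul a (c • b) = c • tmul a b := by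
  simp [tmul, TensorProduct.tmul_smul, map_smul]

lemma zero_tmul (b : B) : tmul (0 : A) b = 0 := by
  simp [tmul]

lemma tmul_zero (a : A) : tmul a (0 : B) = 0 := by
  simp [tmul]

/-- The representation `π ⊗ ρ` of the minimal tensor product. -/
def rep {H K : Type u} [NormedAddCommGroup H] [InnerProductSpace ℂ H] [CompleteSpace H]
    [NormedAddCommGroup K] [InnerProductSpace ℂ K] [CompleteSpace K]
    (π : A →⋆ₐ[ℂ] (H →L[ℂ] H)) (ρ : B →⋆ₐ[ℂ] (K →L[ℂ] K)) :
    MinTensor A B →⋆ₐ[ℂ] (HilbertTensor H K →L[ℂ] HilbertTensor H K) :=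
  (minTensorNorm A B).lift (algTensorRep π ρ)
    (fun x => CStarSeminorm.le_ofFamily
      (fun i : RepPair A B => (HilbertTensor i.H i.K →L[ℂ] HilbertTensor i.H i.K))
      (fun i => algTensorRep i.π i.ρ) (bddAbove_repPair A B) ⟨π, ρ⟩ x)

lemma rep_ofAlg {H K : Type u} [NormedAddCommGroup H] [InnerProductSpace ℂ H] [CompleteSpace H]
    [NormedAddCommGroup K] [InnerProductSpace ℂ K] [CompleteSpace K]
    (π : A →⋆ₐ[ℂ] (H →L[ℂ] H)) (ρ : B →⋆ₐ[ℂ] (K →L[ℂ] K)) (x : A ⊗[ℂ] B) :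
    rep π ρ (ofAlg x) = algTensorRep π ρ x :=
  CStarSeminorm.lift_toCompletion _ _ _ _

lemma rep_tmul {H K : Type u} [NormedAddCommGroup H] [InnerProductSpace ℂ H] [CompleteSpace H]
    [NormedAddCommGroup K] [InnerProductSpace ℂ K] [CompleteSpace K]
    (π : A →⋆ₐ[ℂ] (H →L[ℂ] H)) (ρ : B →⋆ₐ[ℂ] (K →L[ℂ] K)) (a : A) (b : B) :
    rep π ρ (tmul a b) = HilbertTensor.op (π a) (ρ b) := rep_ofAlg _ _ _

lemma norm_ofAlg_le {x : A ⊗[ℂ] B} {C : ℝ} (hC : 0 ≤ C)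
    (h : ∀ i : RepPair A B, ‖algTensorRep i.π i.ρ x‖ ≤ C) : ‖ofAlg x‖ ≤ C :=
  ((minTensorNorm A B).norm_toCompletion x).trans_le (Real.iSup_le h hC)

lemma hom_ext {D : Type v} [CStarAlgebra D] {φ ψ : MinTensor A B →⋆ₐ[ℂ] D}
    (h : ∀ a b, φ (tmul a b) = ψ (tmul a b)) : φ = ψ := by
  refine (minTensorNorm A B).hom_ext fun x => ?_
  change φ (ofAlg x) = ψ (ofAlg x)
  induction x with
  | zero => simp
  | add x y hx hy => simp only [map_add, hx, hy]
  | tmul a b => exact h a b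

variable {A' B' : Type u} [CStarAlgebra A'] [CStarAlgebra B']

/-- The algebraic version of `map`. -/
def algMap (φ : A →⋆ₐ[ℂ] A') (ψ : B →⋆ₐ[ℂ] B') : A ⊗[ℂ] B →⋆ₐ[ℂ] A' ⊗[ℂ] B' where
  toAlgHom := Algebra.TensorProduct.map φ.toAlgHom ψ.toAlgHom
  map_star' x := by
    induction x with
    | zero => simp
    | add x y hx hy => simp only [star_add, AlgHom.toRingHom_eq_coe] at *; simp_all
    | tmul a b =>
      change φ (star a) ⊗ₜ[ℂ] ψ (star b) = star (φ a ⊗ₜ[ℂ] ψ b)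
      rw [map_star, map_star, TensorProduct.star_tmul]

lemma norm_ofAlg_algMap_le (φ : A →⋆ₐ[ℂ] A') (ψ : B →⋆ₐ[ℂ] B') (x : A ⊗[ℂ] B) :
    ‖ofAlg (algMap φ ψ x)‖ ≤ (minTensorNorm A B).toFun x := by
  refine norm_ofAlg_le (Real.iSup_nonneg fun _ => norm_nonneg _) fun i => ?_
  have h : algTensorRep i.π i.ρ (algMap φ ψ x) =
      algTensorRep (i.π.comp φ) (i.ρ.comp ψ) x := by
    induction x with
    | zero => simp
    | add x y hx hy => simp only [map_add, hx, hy]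
    | tmul a b => rfl
  rw [h]
  exact CStarSeminorm.le_ofFamily
      (fun i : RepPair A B => (HilbertTensor i.H i.K →L[ℂ] HilbertTensor i.H i.K))
      (fun i => algTensorRep i.π i.ρ) (bddAbove_repPair A B) ⟨i.π.comp φ, i.ρ.comp ψ⟩ x

/-- The *-homomorphism `φ ⊗ ψ` between minimal tensor products. -/
def map (φ : A →⋆ₐ[ℂ] A') (ψ : B →⋆ₐ[ℂ] B') : MinTensor A B →⋆ₐ[ℂ] MinTensor A' B' :=
  (minTensorNorm A B).lift (ofAlg.comp (algMap φ ψ)) (norm_ofAlg_algMap_le φ ψ)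

@[simp] lemma map_tmul (φ : A →⋆ₐ[ℂ] A') (ψ : B →⋆ₐ[ℂ] B') (a : A) (b : B) :
    map φ ψ (tmul a b) = tmul (φ a) (ψ b) :=
  CStarSeminorm.lift_toCompletion _ _ _ _

variable {C : Type u} [CStarAlgebra C]

/-- `u ∈ (A ⊗ B) ⊗ C` and `v ∈ A ⊗ (B ⊗ C)` correspond to each other under the canonical
identification of these two algebras: for all representations of `A`, `B`, `C` on Hilbert spaces
`H₁`, `H₂`, `H₃`, they act as the same operator on `H₁ ⊗ H₂ ⊗ H₃`, that is, the operators
have the same matrix coefficients with respect to elementary tensors. -/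
def AssocEq (s : MinTensor (MinTensor A B) C) (t : MinTensor A (MinTensor B C)) : Prop :=
  ∀ (H₁ H₂ H₃ : Type u)
    [NormedAddCommGroup H₁] [InnerProductSpace ℂ H₁] [CompleteSpace H₁]
    [NormedAddCommGroup H₂] [InnerProductSpace ℂ H₂] [CompleteSpace H₂]
    [NormedAddCommGroup H₃] [InnerProductSpace ℂ H₃] [CompleteSpace H₃]
    (π₁ : A →⋆ₐ[ℂ] (H₁ →L[ℂ] H₁)) (π₂ : B →⋆ₐ[ℂ] (H₂ →L[ℂ] H₂)) (π₃ : C →⋆ₐ[ℂ] (H₃ →L[ℂ] H₃))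
    (ξ₁ η₁ : H₁) (ξ₂ η₂ : H₂) (ξ₃ η₃ : H₃),
    inner ℂ (HilbertTensor.tmul (HilbertTensor.tmul η₁ η₂) η₃)
        (rep (rep π₁ π₂) π₃ s (HilbertTensor.tmul (HilbertTensor.tmul ξ₁ ξ₂) ξ₃)) =
      inner ℂ (HilbertTensor.tmul η₁ (HilbertTensor.tmul η₂ η₃))
        (rep π₁ (rep π₂ π₃) t (HilbertTensor.tmul ξ₁ (HilbertTensor.tmul ξ₂ ξ₃)))

lemma assocEq_tmul (a : A) (b : B) (c : C) :
    AssocEq (tmul (tmul a b) c) (tmul a (tmul b c)) := by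
  intro H₁ H₂ H₃ _ _ _ _ _ _ _ _ _ π₁ π₂ π₃ ξ₁ η₁ ξ₂ η₂ ξ₃ η₃
  simp only [rep_tmul, HilbertTensor.op_tmul, HilbertTensor.inner_tmul, mul_assoc]

lemma AssocEq.add {s s' : MinTensor (MinTensor A B) C} {t t' : MinTensor A (MinTensor B C)}
    (h : AssocEq s t) (h' : AssocEq s' t') : AssocEq (s + s') (t + t') := by
  intro H₁ H₂ H₃ _ _ _ _ _ _ _ _ _ π₁ π₂ π₃ ξ₁ η₁ ξ₂ η₂ ξ₃ η₃
  simp only [map_add, _root_.add_apply, inner_add_right]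
  rw [h, h']

lemma AssocEq.zero : AssocEq (0 : MinTensor (MinTensor A B) C) 0 := by
  intro H₁ H₂ H₃ _ _ _ _ _ _ _ _ _ π₁ π₂ π₃ ξ₁ η₁ ξ₂ η₂ ξ₃ η₃
  simp

lemma AssocEq.smul {s : MinTensor (MinTensor A B) C} {t : MinTensor A (MinTensor B C)} (c : ℂ)
    (h : AssocEq s t) : AssocEq (c • s) (c • t) := by
  intro H₁ H₂ H₃ _ _ _ _ _ _ _ _ _ π₁ π₂ π₃ ξ₁ η₁ ξ₂ η₂ ξ₃ η₃
  simp only [map_smul, _root_.smul_apply, inner_smul_right]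
  rw [h]

lemma AssocEq.sum {ι : Type*} (I : Finset ι) {s : ι → MinTensor (MinTensor A B) C}
    {t : ι → MinTensor A (MinTensor B C)} (h : ∀ i, AssocEq (s i) (t i)) :
    AssocEq (∑ i ∈ I, s i) (∑ i ∈ I, t i) := by
  classical
  induction I using Finset.induction_on with
  | empty => simpa using AssocEq.zero
  | insert i I hi ih => rw [Finset.sum_insert hi, Finset.sum_insert hi]; exact (h i).add ih

lemma isClosed_assocEq {X : Type*} [TopologicalSpace X] {f : X → MinTensor (MinTensor A B) C}
    {g : X → MinTensor A (MinTensor B C)} (hf : Continuous f) (hg : Continuous g) :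
    IsClosed {x | AssocEq (f x) (g x)} := by
  simp only [AssocEq, Set.ofPred_forall]
  refine isClosed_iInter fun H₁ => isClosed_iInter fun H₂ => isClosed_iInter fun H₃ => ?_
  refine isClosed_iInter fun _ => isClosed_iInter fun _ => isClosed_iInter fun _ => ?_
  refine isClosed_iInter fun _ => isClosed_iInter fun _ => isClosed_iInter fun _ => ?_
  refine isClosed_iInter fun _ => isClosed_iInter fun _ => isClosed_iInter fun _ => ?_
  refine isClosed_iInter fun π₁ => isClosed_iInter fun π₂ => isClosed_iInter fun π₃ => ?_
  refine isClosed_iInter fun ξ₁ => isClosed_iInter fun η₁ => isClosed_iInter fun ξ₂ => ?_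
  refine isClosed_iInter fun η₂ => isClosed_iInter fun ξ₃ => isClosed_iInter fun η₃ => ?_
  have h₁ : Continuous fun x => rep (rep π₁ π₂) π₃ (f x) :=
    (CStarSeminorm.starHom_continuous (rep (rep π₁ π₂) π₃)).comp hf
  have h₂ : Continuous fun x => rep π₁ (rep π₂ π₃) (g x) :=
    (CStarSeminorm.starHom_continuous (rep π₁ (rep π₂ π₃))).comp hg
  exact isClosed_eq (continuous_const.inner (h₁.clm_apply continuous_const))
    (continuous_const.inner (h₂.clm_apply continuous_const))

end MinTensor

end MinTensor

/-! ### Compact quantum groups, quantum subgroups, actions, stabilizers -/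

/-- A compact quantum group in the sense of Woronowicz: a nonzero unital C*-algebra `carrier`
(thought of as the functions on the quantum group) with a coassociative comultiplication satisfying
the two density (cancellation) conditions. -/
structure CompactQuantumGroup where
  carrier : Type
  [cstar : CStarAlgebra carrier]
  [nontrivial : Nontrivial carrier]
  comul : carrier →⋆ₐ[ℂ] MinTensor carrier carrier
  coassoc : ∀ a, MinTensor.AssocEq
    (MinTensor.map comul (StarAlgHom.id ℂ carrier) (comul a))
    (MinTensor.map (StarAlgHom.id ℂ carrier) comul (comul a))
  dense_one_tmul : Dense (Submodule.span ℂ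
    {z | ∃ a b, z = comul a * MinTensor.tmul 1 b} : Set (MinTensor carrier carrier))
  dense_tmul_one : Dense (Submodule.span ℂ
    {z | ∃ a b, z = comul a * MinTensor.tmul b 1} : Set (MinTensor carrier carrier))

attribute [instance] CompactQuantumGroup.cstar CompactQuantumGroup.nontrivial

/-- `φ : C(G) → C(H)` is compatible with the comultiplications:
`(φ ⊗ φ) Δ_G = Δ_H φ`. -/
def CompactQuantumGroup.IsMorphism (G H : CompactQuantumGroup)
    (φ : G.carrier →⋆ₐ[ℂ] H.carrier) : Prop :=
  ∀ a, MinTensor.map φ φ (G.comul a) = H.comul (φ a)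

/-- Two compact quantum groups are isomorphic if there is a *-isomorphism of their C*-algebras
which intertwines the comultiplications. -/
def CompactQuantumGroup.IsIsomorphic (G H : CompactQuantumGroup) : Prop :=
  ∃ φ : G.carrier ≃⋆ₐ[ℂ] H.carrier,
    G.IsMorphism H (φ : G.carrier →⋆ₐ[ℂ] H.carrier)

/-- A quantum subgroup of `G`: a compact quantum group `grp` together with a surjective morphism
`π : C(G) → C(grp)`. Up to isomorphism this is the same as the Woronowicz C*-ideal `I = ker π`
of `C(G)`, `π` being the quotient map `C(G) → C(G)/I`. -/
structure QuantumSubgroup (G : CompactQuantumGroup) where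
  grp : CompactQuantumGroup
  π : G.carrier →⋆ₐ[ℂ] grp.carrier
  surjective : Function.Surjective π
  isMorphism : G.IsMorphism grp π

/-- An action of the compact quantum group `G` on the compact Hausdorff space `X`: a unital
*-homomorphism `α : C(X) → C(X) ⊗ C(G)` with `(α ⊗ id) α = (id ⊗ Δ) α` such that
`α(C(X)) (1 ⊗ C(G))` has dense linear span. -/
structure QuantumAction (G : CompactQuantumGroup) (X : Type) [TopologicalSpace X]
    [CompactSpace X] [T2Space X] where
  toHom : C(X, ℂ) →⋆ₐ[ℂ] MinTensor C(X, ℂ) G.carrier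
  coassoc : ∀ f, MinTensor.AssocEq
    (MinTensor.map toHom (StarAlgHom.id ℂ G.carrier) (toHom f))
    (MinTensor.map (StarAlgHom.id ℂ C(X, ℂ)) G.comul (toHom f))
  dense : Dense (Submodule.span ℂ
    {z | ∃ f b, z = toHom f * MinTensor.tmul 1 b} : Set (MinTensor C(X, ℂ) G.carrier))

namespace QuantumSubgroup

variable {G : CompactQuantumGroup} {X : Type} [TopologicalSpace X]
  [CompactSpace X] [T2Space X]

/-- The induced *-homomorphism `α_H = (id ⊗ π) α : C(X) → C(X) ⊗ C(H)`. -/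
def restrict (H : QuantumSubgroup G) (α : QuantumAction G X) :
    C(X, ℂ) →⋆ₐ[ℂ] MinTensor C(X, ℂ) H.grp.carrier :=
  (MinTensor.map (StarAlgHom.id ℂ C(X, ℂ)) H.π).comp α.toHom

/-- The subgroup `H` fixes `Y ⊆ X`: `(ev_y ⊗ id) α_H(f) = f(y) 1` for all `f ∈ C(X)` and
`y ∈ Y`. Both sides are written in
`ℂ ⊗ C(H)`, which is identified with `C(H)` through `b ↦ 1 ⊗ b`. -/
def Fixes (H : QuantumSubgroup G) (α : QuantumAction G X) (Y : Set X) : Prop :=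
  ∀ f : C(X, ℂ), ∀ y ∈ Y,
    MinTensor.map (ContinuousMap.evalStarAlgHom ℂ ℂ y) (StarAlgHom.id ℂ H.grp.carrier)
      (H.restrict α f) = MinTensor.tmul 1 (algebraMap ℂ H.grp.carrier (f y))

/-- `H` is the stabilizer of `Y` under the action `α`: `H` fixes `Y`, and every quantum subgroup
`K` of `G` fixing `Y` is a quantum subgroup of `H` (inside `G`): there is a surjective morphism
`θ : C(H) → C(K)` with `θ π_H = π_K`. -/
def IsStabilizer (H : QuantumSubgroup G) (α : QuantumAction G X) (Y : Set X) : Prop :=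
  H.Fixes α Y ∧ ∀ K : QuantumSubgroup G, K.Fixes α Y →
    ∃ θ : H.grp.carrier →⋆ₐ[ℂ] K.grp.carrier, Function.Surjective θ ∧
      H.grp.IsMorphism K.grp θ ∧ ∀ a, θ (H.π a) = K.π a

end QuantumSubgroup

/-! ### The quantum permutation group -/

/-- A magic unitary: an `n × n` matrix of projections of a C*-algebra whose rows and columns sum
to `1`. -/
structure IsMagicUnitary {n : ℕ} {D : Type u} [CStarAlgebra D] (p : Fin n → Fin n → D) : Prop where
  star_eq : ∀ i j, star (p i j) = p i j
  mul_self : ∀ i j, p i j * p i j = p i j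
  row_sum : ∀ i, ∑ j, p i j = 1
  col_sum : ∀ j, ∑ i, p i j = 1

lemma eq_zero_of_sum_star_mul_self {D : Type u} [CStarAlgebra D] {ι : Type*} (s : Finset ι)
    (x : ι → D) (h : ∑ i ∈ s, star (x i) * x i = 0) : ∀ i ∈ s, x i = 0 := by
  let _ := CStarAlgebra.spectralOrder D
  let _ := CStarAlgebra.spectralOrderedRing D
  intro i hi
  have := (Finset.sum_eq_zero_iff_of_nonneg fun i _ => star_mul_self_nonneg (x i)).1 h i hi
  exact CStarRing.star_mul_self_eq_zero_iff _ |>.1 this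

/-- Projections which sum to `1` are pairwise orthogonal. -/
lemma projections_orthogonal {D : Type u} [CStarAlgebra D] {ι : Type*} [Fintype ι]
    (p : ι → D) (h₁ : ∀ i, star (p i) = p i) (h₂ : ∀ i, p i * p i = p i) (h₃ : ∑ i, p i = 1)
    {i k : ι} (hik : i ≠ k) : p i * p k = 0 := by
  classical
  have key : ∑ j ∈ Finset.univ.erase k, star (p j * p k) * (p j * p k) = 0 := by
    have : ∀ j, star (p j * p k) * (p j * p k) = p k * p j * p k := fun j => by
      rw [star_mul, h₁, h₁, mul_assoc, ← mul_assoc (p j), h₂, mul_assoc]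
    simp only [this]
    have h := Finset.add_sum_erase Finset.univ (fun j => p k * p j * p k) (Finset.mem_univ k)
    rw [← Finset.sum_mul, ← Finset.mul_sum, ← Finset.sum_mul, ← Finset.mul_sum, h₃, mul_one,
      h₂] at h
    simpa [h₂, ← Finset.sum_mul, ← Finset.mul_sum] using h
  exact eq_zero_of_sum_star_mul_self _ _ key i (by simp [hik])

namespace IsMagicUnitary

variable {n : ℕ} {D : Type u} [CStarAlgebra D] {p : Fin n → Fin n → D}

lemma row_mul (hp : IsMagicUnitary p) (i j k : Fin n) :
    p i j * p i k = if j = k then p i j else 0 := by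
  split_ifs with h
  · rw [h, hp.mul_self]
  · exact projections_orthogonal (p i) (hp.star_eq i) (hp.mul_self i) (hp.row_sum i) h

lemma col_mul (hp : IsMagicUnitary p) (i j k : Fin n) :
    p i k * p j k = if i = j then p i k else 0 := by
  split_ifs with h
  · rw [h, hp.mul_self]
  · exact projections_orthogonal (fun i => p i k) (fun i => hp.star_eq i k)
      (fun i => hp.mul_self i k) (hp.col_sum k) h

end IsMagicUnitary

/-- The free unital complex *-algebra on self-adjoint generators indexed by `Fin n × Fin n`. -/
abbrev FreeMatrixAlgebra (n : ℕ) : Type := MonoidAlgebra ℂ (FreeMonoid (Fin n × Fin n))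

namespace FreeMatrixAlgebra

variable {n : ℕ}

def conjScalar : ℂ →+* (FreeMatrixAlgebra n)ᵐᵒᵖ :=
  (algebraMap ℂ (FreeMatrixAlgebra n)ᵐᵒᵖ).comp (starRingEnd ℂ)

def opWord : FreeMonoid (Fin n × Fin n) →* (FreeMatrixAlgebra n)ᵐᵒᵖ :=
  FreeMonoid.lift fun ij => MulOpposite.op (MonoidAlgebra.of ℂ _ (FreeMonoid.of ij))

lemma commute_conjScalar (x : ℂ) (w : FreeMonoid (Fin n × Fin n)) :
    Commute (conjScalar x) (opWord w) :=
  Algebra.commutes (A := (FreeMatrixAlgebra n)ᵐᵒᵖ) (starRingEnd ℂ x) _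

/-- The involution, as a ring homomorphism to the opposite algebra: it maps a word to the
reversed word and conjugates the coefficients. -/
def opHom : FreeMatrixAlgebra n →+* (FreeMatrixAlgebra n)ᵐᵒᵖ :=
  MonoidAlgebra.liftNCRingHom conjScalar opWord commute_conjScalar

lemma opHom_single (w : FreeMonoid (Fin n × Fin n)) (c : ℂ) :
    opHom (MonoidAlgebra.single w c) = conjScalar c * opWord w :=
  MonoidAlgebra.liftNCRingHom_single _ _ _ _ _

/-- The involution: conjugate-linear, antimultiplicative and fixing the generators. -/
instance : Star (FreeMatrixAlgebra n) where
  star x := (opHom x).unop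

lemma star_def (x : FreeMatrixAlgebra n) : star x = (opHom x).unop := rfl

lemma star_algebraMap (c : ℂ) :
    star (algebraMap ℂ (FreeMatrixAlgebra n) c) = algebraMap ℂ _ (star c) := by
  have : algebraMap ℂ (FreeMatrixAlgebra n) c = MonoidAlgebra.single 1 c := rfl
  rw [star_def, this, opHom_single, map_one, mul_one]
  rfl

/-- The free generators. -/
def gen (i j : Fin n) : FreeMatrixAlgebra n := MonoidAlgebra.of ℂ _ (FreeMonoid.of (i, j))

lemma star_gen (i j : Fin n) : star (gen i j) = gen i j := by
  have : gen i j = MonoidAlgebra.single (FreeMonoid.of (i, j)) (1 : ℂ) := rfl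
  rw [star_def, this, opHom_single, map_one, one_mul, opWord, FreeMonoid.lift_eval_of]
  rfl

lemma induction {P : FreeMatrixAlgebra n → Prop} (hc : ∀ c : ℂ, P (algebraMap ℂ _ c))
    (hg : ∀ i j, P (gen i j)) (ha : ∀ x y, P x → P y → P (x + y))
    (hm : ∀ x y, P x → P y → P (x * y)) (x : FreeMatrixAlgebra n) : P x := by
  refine MonoidAlgebra.induction_on x (fun w => ?_) ha (fun c y hy => ?_)
  · induction w using FreeMonoid.inductionOn' with
    | one => simpa using hc 1
    | of_mul b w ih => rw [map_mul]; exact hm _ _ (hg b.1 b.2) ih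
  · rw [Algebra.smul_def]; exact hm _ _ (hc c) hy

lemma star_mul' (x y : FreeMatrixAlgebra n) : star (x * y) = star y * star x := by
  simp only [star_def, map_mul, MulOpposite.unop_mul]

lemma star_add' (x y : FreeMatrixAlgebra n) : star (x + y) = star x + star y := by
  simp only [star_def, map_add, MulOpposite.unop_add]

instance : StarRing (FreeMatrixAlgebra n) where
  star_mul := star_mul'
  star_add := star_add'
  star_involutive := by
    intro x
    induction x using induction with
    | hc c => rw [star_algebraMap, star_algebraMap, star_star]
    | hg i j => rw [star_gen, star_gen]
    | ha x y hx hy => rw [star_add', star_add', hx, hy]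
    | hm x y hx hy => rw [star_mul', star_mul', hx, hy]

instance : StarModule ℂ (FreeMatrixAlgebra n) where
  star_smul c x := by
    rw [Algebra.smul_def, star_mul, star_algebraMap, Algebra.smul_def, Algebra.commutes]

/-- The algebra homomorphism sending the generators to a given matrix. -/
def liftAlg {D : Type u} [Ring D] [Algebra ℂ D] (p : Fin n → Fin n → D) :
    FreeMatrixAlgebra n →ₐ[ℂ] D :=
  MonoidAlgebra.lift ℂ D _ (FreeMonoid.lift fun ij => p ij.1 ij.2)

lemma liftAlg_gen {D : Type u} [Ring D] [Algebra ℂ D] (p : Fin n → Fin n → D) (i j : Fin n) :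
    liftAlg p (gen i j) = p i j := by
  simp [liftAlg, gen]

/-- The *-homomorphism sending the generators to a given matrix of self-adjoint elements. -/
def lift {D : Type u} [CStarAlgebra D] (p : Fin n → Fin n → D) (h : ∀ i j, star (p i j) = p i j) :
    FreeMatrixAlgebra n →⋆ₐ[ℂ] D where
  toAlgHom := liftAlg p
  map_star' x := by
    change liftAlg p (star x) = star (liftAlg p x)
    induction x using induction with
    | hc c =>
      rw [star_algebraMap, AlgHom.commutes, AlgHom.commutes, algebraMap_star_comm]
    | hg i j => rw [star_gen, liftAlg_gen, h]
    | ha x y hx hy => rw [star_add, map_add, map_add, star_add, hx, hy]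
    | hm x y hx hy => rw [star_mul, map_mul, map_mul, star_mul, hx, hy]

lemma lift_gen {D : Type u} [CStarAlgebra D] (p : Fin n → Fin n → D)
    (h : ∀ i j, star (p i j) = p i j) (i j : Fin n) : lift p h (gen i j) = p i j :=
  liftAlg_gen p i j

end FreeMatrixAlgebra

/-- A magic unitary with entries in some C*-algebra. -/
structure MagicUnitary (n : ℕ) where
  D : Type
  [cstar : CStarAlgebra D]
  p : Fin n → Fin n → D
  isMagic : IsMagicUnitary p

attribute [instance] MagicUnitary.cstar

lemma norm_le_one_of_projection {D : Type u} [CStarAlgebra D] {p : D} (h₁ : star p = p)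
    (h₂ : p * p = p) : ‖p‖ ≤ 1 := by
  have h := CStarRing.norm_star_mul_self (x := p)
  rw [h₁, h₂] at h
  nlinarith [norm_nonneg p]

lemma bddAbove_magic (n : ℕ) (x : FreeMatrixAlgebra n) :
    BddAbove (Set.range fun u : MagicUnitary n =>
      ‖FreeMatrixAlgebra.lift u.p u.isMagic.star_eq x‖) := by
  suffices h : ∃ C, ∀ u : MagicUnitary n, ‖FreeMatrixAlgebra.lift u.p u.isMagic.star_eq x‖ ≤ C by
    obtain ⟨C, hC⟩ := h
    exact ⟨C, by rintro _ ⟨i, rfl⟩; exact hC i⟩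
  induction x using FreeMatrixAlgebra.induction with
  | hc c =>
    refine ⟨‖c‖, fun u => ?_⟩
    rw [AlgHomClass.commutes, Algebra.algebraMap_eq_smul_one, norm_smul]
    exact mul_le_of_le_one_right (norm_nonneg _) (norm_le_one_of_projection (star_one _) (one_mul _))
  | hg i j =>
    refine ⟨1, fun u => ?_⟩
    rw [FreeMatrixAlgebra.lift_gen]
    exact norm_le_one_of_projection (u.isMagic.star_eq i j) (u.isMagic.mul_self i j)
  | ha x y hx hy =>
    obtain ⟨C, hC⟩ := hx
    obtain ⟨E, hE⟩ := hy
    exact ⟨C + E, fun u => by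
      rw [map_add]; exact (norm_add_le _ _).trans (add_le_add (hC u) (hE u))⟩
  | hm x y hx hy =>
    obtain ⟨C, hC⟩ := hx
    obtain ⟨E, hE⟩ := hy
    exact ⟨C * E, fun u => by
      rw [map_mul]
      exact (norm_mul_le _ _).trans (mul_le_mul (hC u) (hE u) (norm_nonneg _)
        ((norm_nonneg _).trans (hC u)))⟩

/-- The largest C*-seminorm on the free *-algebra for which the generators form a magic unitary. -/
def magicNorm (n : ℕ) : CStarSeminorm (FreeMatrixAlgebra n) :=
  CStarSeminorm.ofFamily (fun u : MagicUnitary n => u.D)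
    (fun u => FreeMatrixAlgebra.lift u.p u.isMagic.star_eq) (bddAbove_magic n)

/-- The C*-algebra `A_s(n)`: the universal unital C*-algebra generated by the entries of an
`n × n` magic unitary. -/
def QuantumPermutationAlgebra (n : ℕ) : Type := (magicNorm n).Completion

instance (n : ℕ) : CStarAlgebra (QuantumPermutationAlgebra n) :=
  inferInstanceAs (CStarAlgebra (magicNorm n).Completion)

namespace QuantumPermutationAlgebra

variable {n : ℕ}

def ofFree : FreeMatrixAlgebra n →⋆ₐ[ℂ] QuantumPermutationAlgebra n := (magicNorm n).toCompletion

lemma denseRange_ofFree : DenseRange (ofFree : FreeMatrixAlgebra n →⋆ₐ[ℂ] _) :=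
  (magicNorm n).denseRange_toCompletion

/-- The canonical generators `a_{ij}` of `A_s(n)`. -/
def gen (i j : Fin n) : QuantumPermutationAlgebra n := ofFree (FreeMatrixAlgebra.gen i j)

lemma ofFree_eq_of_forall {x y : FreeMatrixAlgebra n}
    (h : ∀ u : MagicUnitary n, FreeMatrixAlgebra.lift u.p u.isMagic.star_eq x =
      FreeMatrixAlgebra.lift u.p u.isMagic.star_eq y) :
    (ofFree x : QuantumPermutationAlgebra n) = ofFree y := by
  rw [← sub_eq_zero, ← map_sub, ← norm_eq_zero]
  refine ((magicNorm n).norm_toCompletion _).trans ?_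
  change (⨆ u : MagicUnitary n, _) = _
  simp only [map_sub, h, sub_self, norm_zero]
  exact Real.iSup_const_zero

lemma isMagicUnitary_gen : IsMagicUnitary (gen : Fin n → Fin n → QuantumPermutationAlgebra n) where
  star_eq i j := by rw [gen, ← map_star, FreeMatrixAlgebra.star_gen]
  mul_self i j := by
    rw [gen, ← map_mul]
    refine ofFree_eq_of_forall fun u => ?_
    rw [map_mul, FreeMatrixAlgebra.lift_gen, u.isMagic.mul_self]
  row_sum i := by
    simp only [gen]
    rw [← map_sum, ← map_one ofFree]
    refine ofFree_eq_of_forall fun u => ?_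
    simp only [map_sum, FreeMatrixAlgebra.lift_gen, map_one, u.isMagic.row_sum]
  col_sum j := by
    simp only [gen]
    rw [← map_sum, ← map_one ofFree]
    refine ofFree_eq_of_forall fun u => ?_
    simp only [map_sum, FreeMatrixAlgebra.lift_gen, map_one, u.isMagic.col_sum]

/-- The universal property of `A_s(n)`. -/
def lift {D : Type} [CStarAlgebra D] (p : Fin n → Fin n → D) (hp : IsMagicUnitary p) :
    QuantumPermutationAlgebra n →⋆ₐ[ℂ] D :=
  (magicNorm n).lift (FreeMatrixAlgebra.lift p hp.star_eq)
    (fun x => CStarSeminorm.le_ofFamily (fun u : MagicUnitary n => u.D)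
      (fun u => FreeMatrixAlgebra.lift u.p u.isMagic.star_eq) (bddAbove_magic n) ⟨D, p, hp⟩ x)

lemma lift_ofFree {D : Type} [CStarAlgebra D] (p : Fin n → Fin n → D) (hp : IsMagicUnitary p)
    (x : FreeMatrixAlgebra n) : lift p hp (ofFree x) = FreeMatrixAlgebra.lift p hp.star_eq x :=
  CStarSeminorm.lift_toCompletion _ _ _ _

@[simp] lemma lift_gen {D : Type} [CStarAlgebra D] (p : Fin n → Fin n → D) (hp : IsMagicUnitary p)
    (i j : Fin n) : lift p hp (gen i j) = p i j :=
  (lift_ofFree p hp _).trans (FreeMatrixAlgebra.lift_gen _ _ _ _)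

lemma hom_ext {D : Type} [CStarAlgebra D] {φ ψ : QuantumPermutationAlgebra n →⋆ₐ[ℂ] D}
    (h : ∀ i j, φ (gen i j) = ψ (gen i j)) : φ = ψ := by
  refine (magicNorm n).hom_ext fun x => ?_
  change φ (ofFree x) = ψ (ofFree x)
  induction x using FreeMatrixAlgebra.induction with
  | hc c => rw [AlgHomClass.commutes, AlgHomClass.commutes, AlgHomClass.commutes]
  | hg i j => exact h i j
  | ha x y hx hy => simp only [map_add, hx, hy]
  | hm x y hx hy => simp only [map_mul, hx, hy]

instance : Nontrivial (QuantumPermutationAlgebra n) := by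
  have h : IsMagicUnitary fun i j : Fin n => if i = j then (1 : ℂ) else 0 :=
    { star_eq := fun i j => by split_ifs <;> simp
      mul_self := fun i j => by split_ifs <;> simp
      row_sum := fun i => by simp
      col_sum := fun j => by simp }
  exact (lift _ h : QuantumPermutationAlgebra n →⋆ₐ[ℂ] ℂ).toAlgHom.toRingHom.domain_nontrivial

lemma isMagicUnitary_comul : IsMagicUnitary fun i j : Fin n =>
    ∑ k, MinTensor.tmul (gen i k : QuantumPermutationAlgebra n)
      (gen k j : QuantumPermutationAlgebra n) where
  star_eq i j := by
    simp only [star_sum, MinTensor.star_tmul, isMagicUnitary_gen.star_eq]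
  mul_self i j := by
    simp only [Finset.sum_mul_sum, MinTensor.tmul_mul_tmul, isMagicUnitary_gen.row_mul]
    refine Finset.sum_congr rfl fun k _ => ?_
    rw [Finset.sum_eq_single k]
    · rw [if_pos rfl, isMagicUnitary_gen.mul_self]
    · intro l _ hl
      rw [if_neg hl.symm, MinTensor.zero_tmul]
    · simp
  row_sum i := by
    rw [Finset.sum_comm]
    simp only [← MinTensor.tmul_sum, isMagicUnitary_gen.row_sum, ← MinTensor.sum_tmul,
      MinTensor.tmul_one_one]
  col_sum j := by
    rw [Finset.sum_comm]
    simp only [← MinTensor.sum_tmul, isMagicUnitary_gen.col_sum, ← MinTensor.tmul_sum,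
      MinTensor.tmul_one_one]

/-- The comultiplication `Δ(a_{ij}) = ∑_k a_{ik} ⊗ a_{kj}` of `A_s(n)`. -/
def comul : QuantumPermutationAlgebra n →⋆ₐ[ℂ]
    MinTensor (QuantumPermutationAlgebra n) (QuantumPermutationAlgebra n) :=
  lift _ isMagicUnitary_comul

lemma comul_gen (i j : Fin n) : comul (gen i j) = ∑ k, MinTensor.tmul (gen i k) (gen k j) :=
  lift_gen _ _ _ _

end QuantumPermutationAlgebra

/-! ### `A_s(n)` as a compact quantum group, and its action on `n` points -/

section Density

variable {E B A M : Type u} [CStarAlgebra E] [CStarAlgebra B] [CStarAlgebra A] [CStarAlgebra M]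

/-- A criterion for density of the span of `α(E) ι₂(A)`. -/
lemma dense_span_of_generators (α : E →⋆ₐ[ℂ] M) (ι₁ : B →⋆ₐ[ℂ] M) (ι₂ : A →⋆ₐ[ℂ] M)
    (comm : ∀ b a, ι₁ b * ι₂ a = ι₂ a * ι₁ b)
    (hd : Dense (Submodule.span ℂ {z | ∃ b a, z = ι₁ b * ι₂ a} : Set M))
    (s : Set B) (hB : Dense (Algebra.adjoin ℂ s : Set B))
    (hs : ∀ x ∈ s, ι₁ x ∈ Submodule.span ℂ {z | ∃ e a, z = α e * ι₂ a}) :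
    Dense (Submodule.span ℂ {z | ∃ e a, z = α e * ι₂ a} : Set M) := by
  set S : Set M := {z | ∃ e a, z = α e * ι₂ a} with hS
  have hright : ∀ z ∈ Submodule.span ℂ S, ∀ a, z * ι₂ a ∈ Submodule.span ℂ S := by
    intro z hz a
    induction hz using Submodule.span_induction with
    | mem z hz =>
      obtain ⟨e, a', rfl⟩ := hz
      exact Submodule.subset_span ⟨e, a' * a, by rw [map_mul, mul_assoc]⟩
    | zero => simp
    | add x y _ _ hx hy => rw [add_mul]; exact Submodule.add_mem _ hx hy
    | smul c x _ hx => rw [smul_mul_assoc]; exact Submodule.smul_mem _ _ hx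
  have hleft : ∀ z ∈ Submodule.span ℂ S, ∀ e, α e * z ∈ Submodule.span ℂ S := by
    intro z hz e
    induction hz using Submodule.span_induction with
    | mem z hz =>
      obtain ⟨e', a', rfl⟩ := hz
      exact Submodule.subset_span ⟨e * e', a', by rw [map_mul, mul_assoc]⟩
    | zero => simp
    | add x y _ _ hx hy => rw [mul_add]; exact Submodule.add_mem _ hx hy
    | smul c x _ hx => rw [mul_smul_comm]; exact Submodule.smul_mem _ _ hx
  have hadj : ∀ x ∈ Algebra.adjoin ℂ s, ι₁ x ∈ Submodule.span ℂ S := by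
    intro x hx
    induction hx using Algebra.adjoin_induction with
    | mem x hx => exact hs x hx
    | algebraMap c =>
      rw [AlgHomClass.commutes, Algebra.algebraMap_eq_smul_one]
      exact Submodule.smul_mem _ _ (Submodule.subset_span ⟨1, 1, by simp⟩)
    | add x y _ _ hx hy => rw [map_add]; exact Submodule.add_mem _ hx hy
    | mul x y _ _ hx hy =>
      rw [map_mul]
      generalize ι₁ x = z at hx
      induction hx using Submodule.span_induction with
      | mem z hz =>
        obtain ⟨e, a, rfl⟩ := hz
        rw [mul_assoc, ← comm, ← mul_assoc]
        exact hright _ (hleft _ hy e) a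
      | zero => simp
      | add x y _ _ hx hy => rw [add_mul]; exact Submodule.add_mem _ hx hy
      | smul c x _ hx => rw [smul_mul_assoc]; exact Submodule.smul_mem _ _ hx
  have hall : ∀ x a, ι₁ x * ι₂ a ∈ (Submodule.span ℂ S).topologicalClosure := by
    intro x a
    refine hB.induction (P := fun x => ι₁ x * ι₂ a ∈ (Submodule.span ℂ S).topologicalClosure)
      (fun x hx => Submodule.le_topologicalClosure _ (hright _ (hadj x hx) a)) ?_ x
    exact (Submodule.isClosed_topologicalClosure _).preimage
      ((CStarSeminorm.starHom_continuous ι₁).mul continuous_const)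
  have hle : Submodule.span ℂ {z | ∃ b a, z = ι₁ b * ι₂ a} ≤
      (Submodule.span ℂ S).topologicalClosure := by
    rw [Submodule.span_le]
    rintro _ ⟨b, a, rfl⟩
    exact hall b a
  have : Dense ((Submodule.span ℂ S).topologicalClosure : Set M) := hd.mono hle
  rw [Submodule.topologicalClosure_coe] at this
  exact dense_closure.1 this

end Density

namespace MinTensor

variable {A B : Type u} [CStarAlgebra A] [CStarAlgebra B]

/-- `a ↦ a ⊗ 1`. -/
def inl : A →⋆ₐ[ℂ] MinTensor A B where
  toFun a := tmul a 1
  map_one' := tmul_one_one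
  map_mul' a b := by rw [tmul_mul_tmul, one_mul]
  map_zero' := zero_tmul _
  map_add' a b := by simp [tmul, TensorProduct.add_tmul]
  commutes' c := by
    rw [Algebra.algebraMap_eq_smul_one, smul_tmul, tmul_one_one, Algebra.algebraMap_eq_smul_one]
  map_star' a := by rw [star_tmul, star_one]

/-- `b ↦ 1 ⊗ b`. -/
def inr : B →⋆ₐ[ℂ] MinTensor A B where
  toFun b := tmul 1 b
  map_one' := tmul_one_one
  map_mul' a b := by rw [tmul_mul_tmul, one_mul]
  map_zero' := tmul_zero _
  map_add' a b := by simp [tmul, TensorProduct.tmul_add]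
  commutes' c := by
    rw [Algebra.algebraMap_eq_smul_one, tmul_smul, tmul_one_one, Algebra.algebraMap_eq_smul_one]
  map_star' a := by rw [star_tmul, star_one]

lemma inl_apply (a : A) : (inl a : MinTensor A B) = tmul a 1 := rfl
lemma inr_apply (b : B) : (inr b : MinTensor A B) = tmul 1 b := rfl

lemma inl_mul_inr (a : A) (b : B) : (inl a * inr b : MinTensor A B) = tmul a b := by
  rw [inl_apply, inr_apply, tmul_mul_tmul, one_mul, mul_one]

lemma inr_mul_inl (a : A) (b : B) : (inr b * inl a : MinTensor A B) = tmul a b := by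
  rw [inl_apply, inr_apply, tmul_mul_tmul, one_mul, mul_one]

lemma inl_inr_comm (a : A) (b : B) : (inl a * inr b : MinTensor A B) = inr b * inl a := by
  rw [inl_mul_inr, inr_mul_inl]

lemma dense_span_tmul : Dense (Submodule.span ℂ {z : MinTensor A B | ∃ a b, z = tmul a b} :
    Set (MinTensor A B)) := by
  refine denseRange_ofAlg.mono ?_
  rintro _ ⟨x, rfl⟩
  induction x with
  | zero => rw [map_zero]; exact Submodule.zero_mem _
  | add x y hx hy => rw [map_add]; exact Submodule.add_mem _ hx hy
  | tmul a b => exact Submodule.subset_span ⟨a, b, rfl⟩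

lemma dense_span_inl_inr : Dense (Submodule.span ℂ {z : MinTensor A B | ∃ a b, z = inl a * inr b} :
    Set (MinTensor A B)) := by
  simpa only [inl_mul_inr] using dense_span_tmul

lemma dense_span_inr_inl : Dense (Submodule.span ℂ {z : MinTensor A B | ∃ b a, z = inr b * inl a} :
    Set (MinTensor A B)) := by
  simp only [inr_mul_inl]
  rw [show {z : MinTensor A B | ∃ b a, z = tmul a b} = {z | ∃ a b, z = tmul a b} from
    Set.ext fun z => exists_comm]
  exact dense_span_tmul

/-- The special case of `dense_span_of_generators` where all of `B ⊗ 1` is in the span. -/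
lemma dense_span_of_forall (α : B →⋆ₐ[ℂ] MinTensor B A)
    (hs : ∀ x : B, tmul x 1 ∈ Submodule.span ℂ {z | ∃ e a, z = α e * tmul 1 a}) :
    Dense (Submodule.span ℂ {z | ∃ e a, z = α e * tmul 1 a} : Set (MinTensor B A)) :=
  dense_span_of_generators α inl inr inl_inr_comm dense_span_inl_inr Set.univ
    (dense_univ.mono Algebra.subset_adjoin) fun x _ => hs x

section Triple

variable {C : Type u} [CStarAlgebra C]

/-- `(a ⊗ b) ⊗ c ↦ (a ⊗ b) ⊗ c`. -/
def tripleLeft : (A ⊗[ℂ] B) ⊗[ℂ] C →ₐ[ℂ] MinTensor (MinTensor A B) C :=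
  (ofAlg : MinTensor A B ⊗[ℂ] C →⋆ₐ[ℂ] _).toAlgHom.comp
    (Algebra.TensorProduct.map ofAlg.toAlgHom (AlgHom.id ℂ C))

/-- `(a ⊗ b) ⊗ c ↦ a ⊗ (b ⊗ c)`. -/
def tripleRight : (A ⊗[ℂ] B) ⊗[ℂ] C →ₐ[ℂ] MinTensor A (MinTensor B C) :=
  ((ofAlg : A ⊗[ℂ] MinTensor B C →⋆ₐ[ℂ] _).toAlgHom.comp
    (Algebra.TensorProduct.map (AlgHom.id ℂ A) ofAlg.toAlgHom)).comp
    (Algebra.TensorProduct.assoc ℂ ℂ ℂ A B C).toAlgHom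

lemma tripleLeft_tmul (a : A) (b : B) (c : C) :
    tripleLeft ((a ⊗ₜ[ℂ] b) ⊗ₜ[ℂ] c) = tmul (tmul a b) c := rfl

lemma tripleRight_tmul (a : A) (b : B) (c : C) :
    tripleRight ((a ⊗ₜ[ℂ] b) ⊗ₜ[ℂ] c) = tmul a (tmul b c) := rfl

lemma assocEq_triple (w : (A ⊗[ℂ] B) ⊗[ℂ] C) : AssocEq (tripleLeft w) (tripleRight w) := by
  induction w with
  | zero => rw [map_zero, map_zero]; exact AssocEq.zero
  | add x y hx hy => rw [map_add, map_add]; exact hx.add hy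
  | tmul x c =>
    induction x with
    | zero => rw [TensorProduct.zero_tmul, map_zero, map_zero]; exact AssocEq.zero
    | add x y hx hy => rw [TensorProduct.add_tmul, map_add, map_add]; exact hx.add hy
    | tmul a b => exact assocEq_tmul a b c

end Triple

end MinTensor

namespace QuantumPermutationAlgebra

variable {n : ℕ}

lemma comul_coassoc (a : QuantumPermutationAlgebra n) : MinTensor.AssocEq
    (MinTensor.map comul (StarAlgHom.id ℂ _) (comul a))
    (MinTensor.map (StarAlgHom.id ℂ _) comul (comul a)) := by
  have hc : Continuous (comul : QuantumPermutationAlgebra n →⋆ₐ[ℂ] _) :=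
    CStarSeminorm.starHom_continuous _
  refine denseRange_ofFree.induction_on (p := fun a => MinTensor.AssocEq
    (MinTensor.map comul (StarAlgHom.id ℂ _) (comul a))
    (MinTensor.map (StarAlgHom.id ℂ _) comul (comul a))) a
    (MinTensor.isClosed_assocEq ((CStarSeminorm.starHom_continuous _).comp hc)
      ((CStarSeminorm.starHom_continuous _).comp hc)) fun x => ?_
  let T : FreeMatrixAlgebra n →ₐ[ℂ] (QuantumPermutationAlgebra n ⊗[ℂ]
      QuantumPermutationAlgebra n) ⊗[ℂ] QuantumPermutationAlgebra n :=
    FreeMatrixAlgebra.liftAlg fun i j => ∑ k, ∑ l, (gen i l ⊗ₜ[ℂ] gen l k) ⊗ₜ[ℂ] gen k j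
  have h₁ : MinTensor.map comul (StarAlgHom.id ℂ (QuantumPermutationAlgebra n))
      (comul (ofFree x)) = MinTensor.tripleLeft (T x) := by
    induction x using FreeMatrixAlgebra.induction with
    | hc c => simp only [AlgHomClass.commutes]
    | hg i j =>
      change MinTensor.map comul (StarAlgHom.id ℂ (QuantumPermutationAlgebra n))
        (comul (gen i j)) = MinTensor.tripleLeft (FreeMatrixAlgebra.liftAlg _ _)
      rw [FreeMatrixAlgebra.liftAlg_gen, comul_gen]
      simp only [map_sum, MinTensor.map_tmul, comul_gen, MinTensor.tripleLeft_tmul,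
        MinTensor.sum_tmul, StarAlgHom.coe_id, id_eq]
    | ha x y hx hy => simp only [map_add, hx, hy]
    | hm x y hx hy => simp only [map_mul, hx, hy]
  have h₂ : MinTensor.map (StarAlgHom.id ℂ (QuantumPermutationAlgebra n)) comul
      (comul (ofFree x)) = MinTensor.tripleRight (T x) := by
    clear h₁
    induction x using FreeMatrixAlgebra.induction with
    | hc c => simp only [AlgHomClass.commutes]
    | hg i j =>
      change MinTensor.map (StarAlgHom.id ℂ (QuantumPermutationAlgebra n)) comul
        (comul (gen i j)) = MinTensor.tripleRight (FreeMatrixAlgebra.liftAlg _ _)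
      rw [FreeMatrixAlgebra.liftAlg_gen, comul_gen, Finset.sum_comm]
      simp only [map_sum, MinTensor.map_tmul, comul_gen, MinTensor.tripleRight_tmul,
        MinTensor.tmul_sum, StarAlgHom.coe_id, id_eq]
    | ha x y hx hy => simp only [map_add, hx, hy]
    | hm x y hx hy => simp only [map_mul, hx, hy]
  rw [h₁, h₂]
  exact MinTensor.assocEq_triple _

lemma dense_adjoin_gen : Dense (Algebra.adjoin ℂ {x : QuantumPermutationAlgebra n | ∃ i j, x = gen i j} :
    Set (QuantumPermutationAlgebra n)) := by
  refine denseRange_ofFree.mono ?_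
  rintro _ ⟨x, rfl⟩
  induction x using FreeMatrixAlgebra.induction with
  | hc c => rw [AlgHomClass.commutes]; exact Subalgebra.algebraMap_mem _ _
  | hg i j => exact Algebra.subset_adjoin ⟨i, j, rfl⟩
  | ha x y hx hy => rw [map_add]; exact Subalgebra.add_mem _ hx hy
  | hm x y hx hy => rw [map_mul]; exact Subalgebra.mul_mem _ hx hy

lemma comul_dense_one_tmul : Dense (Submodule.span ℂ
    {z : MinTensor (QuantumPermutationAlgebra n) (QuantumPermutationAlgebra n) | ∃ a b, z = comul a * MinTensor.tmul 1 b} :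
      Set (MinTensor (QuantumPermutationAlgebra n) (QuantumPermutationAlgebra n))) := by
  refine dense_span_of_generators comul MinTensor.inl MinTensor.inr
    MinTensor.inl_inr_comm
    MinTensor.dense_span_inl_inr _ dense_adjoin_gen ?_
  rintro _ ⟨i, j, rfl⟩
  have : (MinTensor.inl (gen i j) : MinTensor _ (QuantumPermutationAlgebra n)) =
      ∑ k, comul (gen i k) * MinTensor.inr (gen j k) := by
    simp only [comul_gen, Finset.sum_mul, MinTensor.inr_apply, MinTensor.tmul_mul_tmul,
      isMagicUnitary_gen.col_mul, mul_one]
    have h : ∀ k, ∑ l, MinTensor.tmul (gen i l : QuantumPermutationAlgebra n)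
        (if l = j then (gen l k : QuantumPermutationAlgebra n) else 0) =
        MinTensor.tmul (gen i j) (gen j k) := fun k => by
      rw [Finset.sum_eq_single j]
      · rw [if_pos rfl]
      · intro l _ hl
        rw [if_neg hl, MinTensor.tmul_zero]
      · simp
    simp only [h, ← MinTensor.tmul_sum, isMagicUnitary_gen.row_sum, MinTensor.inl_apply]
  rw [this]
  exact Submodule.sum_mem _ fun k _ => Submodule.subset_span ⟨_, _, rfl⟩

lemma comul_dense_tmul_one : Dense (Submodule.span ℂ
    {z : MinTensor (QuantumPermutationAlgebra n) (QuantumPermutationAlgebra n) | ∃ a b, z = comul a * MinTensor.tmul b 1} :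
      Set (MinTensor (QuantumPermutationAlgebra n) (QuantumPermutationAlgebra n))) := by
  refine dense_span_of_generators comul MinTensor.inr MinTensor.inl
    (fun b a => (MinTensor.inl_inr_comm a b).symm)
    MinTensor.dense_span_inr_inl _ dense_adjoin_gen ?_
  rintro _ ⟨i, j, rfl⟩
  have : (MinTensor.inr (gen i j) : MinTensor (QuantumPermutationAlgebra n) _) =
      ∑ k, comul (gen k j) * MinTensor.inl (gen k i) := by
    simp only [comul_gen, Finset.sum_mul, MinTensor.inl_apply, MinTensor.tmul_mul_tmul,
      isMagicUnitary_gen.row_mul, mul_one]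
    have h : ∀ k, ∑ l, MinTensor.tmul
        (if l = i then (gen k l : QuantumPermutationAlgebra n) else 0)
        (gen l j : QuantumPermutationAlgebra n) =
        MinTensor.tmul (gen k i) (gen i j) := fun k => by
      rw [Finset.sum_eq_single i]
      · rw [if_pos rfl]
      · intro l _ hl
        rw [if_neg hl, MinTensor.zero_tmul]
      · simp
    simp only [h, ← MinTensor.sum_tmul, isMagicUnitary_gen.col_sum, MinTensor.inr_apply]
  rw [this]
  exact Submodule.sum_mem _ fun k _ => Submodule.subset_span ⟨_, _, rfl⟩

end QuantumPermutationAlgebra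

/-- The quantum permutation group `A_s(n)`, with `Δ(a_{ij}) = ∑_k a_{ik} ⊗ a_{kj}`. -/
def quantumPermutationGroup (n : ℕ) : CompactQuantumGroup where
  carrier := QuantumPermutationAlgebra n
  comul := QuantumPermutationAlgebra.comul
  coassoc := QuantumPermutationAlgebra.comul_coassoc
  dense_one_tmul := QuantumPermutationAlgebra.comul_dense_one_tmul
  dense_tmul_one := QuantumPermutationAlgebra.comul_dense_tmul_one

/-- The canonical generators `a_{ij}` of `A_s(n)`, as functions on the quantum permutation group. -/
def quantumPermutationGroup.gen {n : ℕ} (i j : Fin n) : (quantumPermutationGroup n).carrier :=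
  QuantumPermutationAlgebra.gen i j

/-- The indicator function `e_i ∈ C(X_n)` of the point `i` of `X_n = Fin n`. -/
def pointFunction {n : ℕ} (i : Fin n) : C(Fin n, ℂ) :=
  ⟨Pi.single i 1, continuous_of_discreteTopology⟩

namespace QuantumPermutationAlgebra

variable {n : ℕ}

lemma pointFunction_apply (i j : Fin n) : pointFunction i j = if j = i then (1 : ℂ) else 0 :=
  Pi.single_apply _ _ _

lemma pointFunction_mul (i j : Fin n) :
    pointFunction i * pointFunction j = if i = j then pointFunction i else 0 := by
  ext k
  rcases eq_or_ne i j with rfl | h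
  · simp [pointFunction_apply]
  · simp only [ContinuousMap.mul_apply, pointFunction_apply, if_neg h, ContinuousMap.zero_apply]
    split_ifs with h₁ h₂ <;> simp_all

lemma star_pointFunction (i : Fin n) : star (pointFunction i) = pointFunction i := by
  ext k
  simp only [ContinuousMap.star_apply, pointFunction_apply]
  split_ifs <;> simp

lemma sum_pointFunction : ∑ i : Fin n, pointFunction i = 1 := by
  ext k
  simp [ContinuousMap.sum_apply, pointFunction_apply]

lemma eq_sum_pointFunction (f : C(Fin n, ℂ)) : f = ∑ i, f i • pointFunction i := by
  ext k
  simp [ContinuousMap.sum_apply, pointFunction_apply]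

/-- The images `∑_j e_j ⊗ a_{ji}` of the functions `e_i`. -/
def coactionPoint (i : Fin n) : MinTensor C(Fin n, ℂ) (QuantumPermutationAlgebra n) :=
  ∑ j, MinTensor.tmul (pointFunction j) (gen j i)

lemma coactionPoint_mul (i k : Fin n) :
    coactionPoint i * coactionPoint k = if i = k then coactionPoint i else 0 := by
  simp only [coactionPoint, Finset.sum_mul_sum, MinTensor.tmul_mul_tmul, pointFunction_mul]
  have h : ∀ j : Fin n, ∑ l : Fin n, MinTensor.tmul (if j = l then pointFunction j else 0)
      (gen j i * gen l k) = MinTensor.tmul (pointFunction j) (gen j i * gen j k) := fun j => by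
    rw [Finset.sum_eq_single j]
    · rw [if_pos rfl]
    · intro l _ hl
      rw [if_neg hl.symm, MinTensor.zero_tmul]
    · simp
  simp only [h, isMagicUnitary_gen.row_mul]
  split_ifs
  · rfl
  · simp [MinTensor.tmul_zero]

lemma coactionPoint_sum : ∑ i : Fin n, coactionPoint i = 1 := by
  simp only [coactionPoint]
  rw [Finset.sum_comm]
  simp only [← MinTensor.tmul_sum, isMagicUnitary_gen.row_sum, ← MinTensor.sum_tmul,
    sum_pointFunction, MinTensor.tmul_one_one]

lemma star_coactionPoint (i : Fin n) : star (coactionPoint i) = coactionPoint i := by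
  simp only [coactionPoint, star_sum, MinTensor.star_tmul, star_pointFunction,
    isMagicUnitary_gen.star_eq]

/-- The *-homomorphism `C(X_n) → C(X_n) ⊗ A_s(n)` with `e_i ↦ ∑_j e_j ⊗ a_{ji}`. -/
def coaction : C(Fin n, ℂ) →⋆ₐ[ℂ] MinTensor C(Fin n, ℂ) (QuantumPermutationAlgebra n) where
  toFun f := ∑ i, f i • coactionPoint i
  map_one' := by simp [coactionPoint_sum]
  map_mul' f g := by
    simp only [Finset.sum_mul_sum, smul_mul_smul_comm, coactionPoint_mul, ContinuousMap.mul_apply]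
    refine Finset.sum_congr rfl fun i _ => ?_
    simp
  map_zero' := by simp
  map_add' f g := by simp [add_smul, Finset.sum_add_distrib]
  commutes' c := by
    simp only [Algebra.algebraMap_eq_smul_one, ContinuousMap.smul_apply,
      ContinuousMap.one_apply, smul_eq_mul, mul_one, ← Finset.smul_sum, coactionPoint_sum]
  map_star' f := by simp [star_sum, star_smul, star_coactionPoint]

lemma coaction_pointFunction (i : Fin n) :
    coaction (pointFunction i) = ∑ j, MinTensor.tmul (pointFunction j) (gen j i) := by
  change ∑ k, (pointFunction i k) • coactionPoint k = coactionPoint i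
  simp [pointFunction_apply]

lemma coaction_coassoc (f : C(Fin n, ℂ)) : MinTensor.AssocEq
    (MinTensor.map coaction (StarAlgHom.id ℂ (QuantumPermutationAlgebra n)) (coaction f))
    (MinTensor.map (StarAlgHom.id ℂ C(Fin n, ℂ)) comul (coaction f)) := by
  rw [eq_sum_pointFunction f]
  simp only [map_sum, map_smul, coaction_pointFunction, MinTensor.map_tmul, comul_gen,
    MinTensor.sum_tmul, MinTensor.tmul_sum, StarAlgHom.coe_id, id_eq]
  refine MinTensor.AssocEq.sum _ fun i => MinTensor.AssocEq.smul _ ?_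
  rw [Finset.sum_comm]
  exact MinTensor.AssocEq.sum _ fun j => MinTensor.AssocEq.sum _ fun k =>
    MinTensor.assocEq_tmul _ _ _

lemma coaction_span (j : Fin n) :
    MinTensor.tmul (pointFunction j) (1 : QuantumPermutationAlgebra n) =
      ∑ i, coaction (pointFunction i) * MinTensor.tmul 1 (gen j i) := by
  have h : ∀ i, coaction (pointFunction i) * MinTensor.tmul 1 (gen j i) =
      MinTensor.tmul (pointFunction j) (gen j i) := fun i => by
    rw [coaction_pointFunction, Finset.sum_mul, Finset.sum_eq_single j]
    · rw [MinTensor.tmul_mul_tmul, mul_one, isMagicUnitary_gen.mul_self]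
    · intro k _ hk
      rw [MinTensor.tmul_mul_tmul, isMagicUnitary_gen.col_mul, if_neg hk, MinTensor.tmul_zero]
    · simp
  simp only [h, ← MinTensor.tmul_sum, isMagicUnitary_gen.row_sum]

lemma coaction_dense : Dense (Submodule.span ℂ
    {z : MinTensor C(Fin n, ℂ) (QuantumPermutationAlgebra n) |
      ∃ f b, z = coaction f * MinTensor.tmul 1 b} :
      Set (MinTensor C(Fin n, ℂ) (QuantumPermutationAlgebra n))) := by
  refine MinTensor.dense_span_of_forall coaction fun f => ?_
  rw [eq_sum_pointFunction f, MinTensor.sum_tmul]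
  refine Submodule.sum_mem _ fun j _ => ?_
  rw [MinTensor.smul_tmul, coaction_span]
  exact Submodule.smul_mem _ _ (Submodule.sum_mem _ fun k _ => Submodule.subset_span ⟨_, _, rfl⟩)

end QuantumPermutationAlgebra

/-- The action of `A_s(n)` on `X_n = Fin n` with `α(e_i) = ∑_j e_j ⊗ a_{ji}`. -/
def permutationAction (n : ℕ) : QuantumAction (quantumPermutationGroup n) (Fin n) where
  toHom := QuantumPermutationAlgebra.coaction
  coassoc := QuantumPermutationAlgebra.coaction_coassoc
  dense := QuantumPermutationAlgebra.coaction_dense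

lemma permutationAction_pointFunction (n : ℕ) (i : Fin n) :
    (permutationAction n).toHom (pointFunction i) =
      ∑ j, MinTensor.tmul (pointFunction j) (quantumPermutationGroup.gen j i) :=
  QuantumPermutationAlgebra.coaction_pointFunction i

end

/-!
Write `n = m + 1`. A quantum subgroup `H` of `A_s(m + 1)` fixes `x` exactly when `π_H(a_{xx}) = 1`
(`QuantumSubgroup.fixes_singleton_iff`): evaluating the action at `x` sends `e_i` to
`1 ⊗ π_H(a_{xi})`, and row `x` of the magic unitary `π_H(a_{ij})` consists of orthogonal projections
with sum `1`, so its other entries vanish as soon as the diagonal one is `1`. Extracting `π_H(a_{xx})`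
from `1 ⊗ π_H(a_{xx}) ∈ ℂ ⊗ C(H)` uses that elementary tensors of nonzero elements are nonzero
(`MinTensor.tmul_eq_zero`), which rests on the existence of GNS representations not killing a given
element.

Inserting a row and a column of the identity matrix at position `x` into the generating magic unitary
of `A_s(m)` gives a magic unitary of size `m + 1`, hence a morphism `A_s(m + 1) → A_s(m)`
(`toStabilizer`), which makes `A_s(m)` a quantum subgroup fixing `x`. The morphism is surjective
because its range contains the generators and a *-homomorphism of C*-algebras with dense range is
surjective (`surjective_of_denseRange`). Conversely, if `K` fixes `x`, then the row and the column of
`x` in `π_K(a_{ij})` are those of the identity matrix; deleting them leaves a magic unitary of size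
`m`, and the universal property of `A_s(m)` factors `π_K` through it
(`QuantumSubgroup.isStabilizer_pointStabilizer`). Finally, any two stabilizers of the same set are
isomorphic, by the usual argument for universal objects.
-/

noncomputable section

universe u v

/-! ### Separating elements of a C*-algebra by representations -/

section Representations

open scoped ComplexOrder

variable {A : Type u} [CStarAlgebra A]

/-- The positive cone is closed and convex, so the Hahn-Banach theorem separates it from a
self-adjoint element outside of it by a positive functional. -/
lemma exists_positiveLinearMap_re_neg [PartialOrder A] [StarOrderedRing A] {a : A}
    (ha : ¬ 0 ≤ a) (hsa : IsSelfAdjoint a) : ∃ f : A →ₚ[ℂ] ℂ, (f a).re < 0 := by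
  obtain ⟨f, hf, hfa⟩ := (ProperCone.positive ℝ A).hyperplane_separation_point (x₀ := a) ha
  -- Precomposing with the real part makes `g` vanish on `i` times a self-adjoint element, so that
  -- its complex-linear extension is real on self-adjoint elements.
  let g : A →ₗ[ℝ] ℝ := f.toLinearMap ∘ₗ (selfAdjoint.submodule ℝ A).subtype ∘ₗ realPart
  have hg : ∀ x : A, IsSelfAdjoint x → Module.Dual.extendRCLike (𝕜 := ℂ) g x = (f x : ℂ) := by
    intro x hx
    have h₁ : g x = f x := congrArg f hx.coe_realPart
    have h₂ : g (Complex.I • x) = 0 := by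
      change f (realPart (Complex.I • x) : A) = 0
      rw [realPart_I_smul, hx.imaginaryPart]
      simp
    rw [Module.Dual.extendRCLike_apply]
    erw [h₂]
    simp [h₁]
  refine ⟨PositiveLinearMap.mk₀ (Module.Dual.extendRCLike (𝕜 := ℂ) g) fun x hx => ?_, ?_⟩
  · rw [hg x (.of_nonneg hx)]
    exact_mod_cast hf x hx
  · change (Module.Dual.extendRCLike (𝕜 := ℂ) g a).re < 0
    rw [hg a hsa]
    exact_mod_cast hfa

lemma exists_rep_apply_ne_zero {a : A} (ha : a ≠ 0) :
    ∃ (H : Type u) (_ : NormedAddCommGroup H) (_ : InnerProductSpace ℂ H) (_ : CompleteSpace H)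
      (π : A →⋆ₐ[ℂ] (H →L[ℂ] H)) (ξ : H), π a ξ ≠ 0 := by
  let _ := CStarAlgebra.spectralOrder A
  let _ := CStarAlgebra.spectralOrderedRing A
  -- A positive functional `f` with `f (a* a) > 0` gives `‖π(a) 1‖² = f (a* a) ≠ 0` in its GNS space.
  have hneg : ¬ 0 ≤ -(star a * a) := fun h => ha <|
    CStarRing.star_mul_self_eq_zero_iff _ |>.1 <|
      le_antisymm (neg_nonneg.1 h) (star_mul_self_nonneg a)
  obtain ⟨f, hf⟩ := exists_positiveLinearMap_re_neg hneg (IsSelfAdjoint.star_mul_self a).neg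
  refine ⟨f.GNS, inferInstance, inferInstance, inferInstance, f.gnsStarAlgHom,
    (f.toPreGNS 1 : f.PreGNS), fun h => ?_⟩
  have h₁ : ((f.leftMulMapPreGNS a (f.toPreGNS 1) : f.PreGNS) : f.GNS) = 0 :=
    f.gnsNonUnitalStarAlgHom_apply_coe.symm.trans h
  have h₂ := f.preGNS_norm_sq (f.leftMulMapPreGNS a (f.toPreGNS 1))
  rw [← UniformSpace.Completion.norm_coe, h₁] at h₂
  simp at h₂
  simp [← h₂] at hf

end Representations

/-! ### Elementary tensors -/

lemma MinTensor.tmul_eq_zero {A B : Type u} [CStarAlgebra A] [CStarAlgebra B] {a : A} {b : B} :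
    tmul a b = 0 ↔ a = 0 ∨ b = 0 := by
  refine ⟨fun h => ?_, ?_⟩
  · by_contra! hab
    obtain ⟨H, _, _, _, π, ξ, hξ⟩ := exists_rep_apply_ne_zero hab.1
    obtain ⟨K, _, _, _, ρ, η, hη⟩ := exists_rep_apply_ne_zero hab.2
    have h' : HilbertTensor.tmul (π a ξ) (ρ b η) = 0 := by
      rw [← HilbertTensor.op_tmul, ← rep_tmul, h, map_zero, _root_.zero_apply]
    have h'' := HilbertTensor.inner_tmul (π a ξ) (π a ξ) (ρ b η) (ρ b η)
    rw [h', inner_zero_left, eq_comm, mul_eq_zero, inner_self_eq_zero, inner_self_eq_zero] at h''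
    exact h''.elim hξ hη
  · rintro (rfl | rfl)
    · exact zero_tmul b
    · exact tmul_zero a

/-! ### Surjectivity of *-homomorphisms with dense range -/

section DenseRange

variable {A : Type u} {B : Type v} [CStarAlgebra A] [CStarAlgebra B] (φ : A →⋆ₐ[ℂ] B)

/-- The preimage is the image of `a` under the continuous functional calculus for the truncation of
the identity to `[-‖φ a‖, ‖φ a‖]`, an interval containing the spectrum of `φ a`. -/
lemma exists_apply_eq_norm_le_of_isSelfAdjoint {a : A} (ha : IsSelfAdjoint a) :
    ∃ a', φ a' = φ a ∧ ‖a'‖ ≤ ‖φ a‖ := by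
  have hφ : Continuous φ := CStarSeminorm.starHom_continuous φ
  set r := ‖φ a‖
  have hφa : IsSelfAdjoint (φ a) := ha.map φ
  refine ⟨cfc (fun t : ℝ => max (-r) (min r t)) a, ?_, ?_⟩
  · rw [StarAlgHom.map_cfc φ _ a]
    conv_rhs => rw [← cfc_id' ℝ (φ a)]
    refine cfc_congr fun t ht => ?_
    have : |t| ≤ r := by
      have : Nontrivial B := by
        by_contra hB
        rw [not_nontrivial_iff_subsingleton] at hB
        simp [spectrum.of_subsingleton] at ht
      simpa using spectrum.norm_le_norm_of_mem ht
    rw [abs_le] at this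
    simp [this.1, this.2]
  · refine norm_cfc_le (norm_nonneg _) fun t _ => ?_
    rw [Real.norm_eq_abs, abs_le]
    have : 0 ≤ r := norm_nonneg _
    exact ⟨le_max_left _ _, max_le (by linarith) (min_le_left _ _)⟩

lemma exists_apply_eq_norm_le (a : A) : ∃ a', φ a' = φ a ∧ ‖a'‖ ≤ 2 * ‖φ a‖ := by
  have hφ : Continuous φ := CStarSeminorm.starHom_continuous φ
  obtain ⟨x, hx, hxn⟩ := exists_apply_eq_norm_le_of_isSelfAdjoint φ (realPart a).2
  obtain ⟨y, hy, hyn⟩ := exists_apply_eq_norm_le_of_isSelfAdjoint φ (imaginaryPart a).2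
  have hre : φ (realPart a) = realPart (φ a) := by
    rw [realPart_apply_coe, realPart_apply_coe, map_real_smul φ hφ, map_add, map_star]
  have him : φ (imaginaryPart a) = imaginaryPart (φ a) := by
    rw [imaginaryPart_apply_coe, imaginaryPart_apply_coe, map_smul, map_real_smul φ hφ, map_sub,
      map_star]
  refine ⟨x + Complex.I • y, ?_, ?_⟩
  · rw [map_add, map_smul, hx, hy, ← map_smul, ← map_add, realPart_add_I_smul_imaginaryPart]
  · rw [hre] at hxn
    rw [him] at hyn
    calc ‖x + Complex.I • y‖ ≤ ‖x‖ + ‖y‖ := by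
          simpa [norm_smul] using norm_add_le x (Complex.I • y)
      _ ≤ ‖φ a‖ + ‖φ a‖ := add_le_add (hxn.trans (realPart.norm_le (φ a)))
          (hyn.trans (imaginaryPart.norm_le (φ a)))
      _ = 2 * ‖φ a‖ := (two_mul _).symm

/-- Every element of the range has a preimage whose norm is controlled by its own norm, so
successive approximation (as in the open mapping theorem) shows that the range is closed. -/
lemma surjective_of_denseRange (h : DenseRange φ) : Function.Surjective φ := by
  let f : NormedAddGroupHom A B :=
    (φ : A →+ B).mkNormedAddGroupHom 1 fun a => by
      rw [one_mul]; exact NonUnitalStarAlgHom.norm_apply_le φ a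
  have hf : f.SurjectiveOnWith f.range 2 := by
    rintro _ ⟨a, rfl⟩
    exact exists_apply_eq_norm_le φ a
  intro b
  obtain ⟨a, ha, -⟩ := controlled_closure_of_complete two_pos one_pos hf b (h b)
  exact ⟨a, ha⟩

end DenseRange
/-! ### Functoriality of the minimal tensor product -/

namespace MinTensor

variable {A B A' B' : Type u} [CStarAlgebra A] [CStarAlgebra B] [CStarAlgebra A'] [CStarAlgebra B']

lemma map_map {A'' B'' : Type u} [CStarAlgebra A''] [CStarAlgebra B'']
    (φ' : A' →⋆ₐ[ℂ] A'') (ψ' : B' →⋆ₐ[ℂ] B'') (φ : A →⋆ₐ[ℂ] A') (ψ : B →⋆ₐ[ℂ] B')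
    (z : MinTensor A B) : map φ' ψ' (map φ ψ z) = map (φ'.comp φ) (ψ'.comp ψ) z := by
  have : (map φ' ψ').comp (map φ ψ) = map (φ'.comp φ) (ψ'.comp ψ) :=
    hom_ext fun a b => by simp
  exact congr($this z)

end MinTensor

/-! ### Deleting and inserting a trivial row and column -/

namespace IsMagicUnitary

variable {m : ℕ} {D : Type u} [CStarAlgebra D]

lemma apply_eq_zero_of_row_eq_one {p : Fin m → Fin m → D} (hp : IsMagicUnitary p) {i j k : Fin m}
    (h : p i j = 1) (hk : k ≠ j) : p i k = 0 := by
  simpa [h, hk] using hp.row_mul i k j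

lemma apply_eq_zero_of_col_eq_one {p : Fin m → Fin m → D} (hp : IsMagicUnitary p) {i j k : Fin m}
    (h : p i j = 1) (hk : k ≠ i) : p k j = 0 := by
  simpa [h, hk] using hp.col_mul k i j

lemma submatrix_succAbove {p : Fin (m + 1) → Fin (m + 1) → D} (hp : IsMagicUnitary p)
    {x : Fin (m + 1)} (h : p x x = 1) :
    IsMagicUnitary fun i j => p (x.succAbove i) (x.succAbove j) where
  star_eq _ _ := hp.star_eq _ _
  mul_self _ _ := hp.mul_self _ _
  row_sum i := by
    have := hp.row_sum (x.succAbove i)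
    rwa [Fin.sum_univ_succAbove _ x, hp.apply_eq_zero_of_col_eq_one h (x.succAbove_ne i),
      zero_add] at this
  col_sum j := by
    have := hp.col_sum (x.succAbove j)
    rwa [Fin.sum_univ_succAbove _ x, hp.apply_eq_zero_of_row_eq_one h (x.succAbove_ne j),
      zero_add] at this

lemma map {p : Fin m → Fin m → D} (hp : IsMagicUnitary p) {E : Type v} [CStarAlgebra E]
    (φ : D →⋆ₐ[ℂ] E) : IsMagicUnitary fun i j => φ (p i j) where
  star_eq i j := by rw [← map_star, hp.star_eq]
  mul_self i j := by rw [← map_mul, hp.mul_self]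
  row_sum i := by rw [← map_sum, hp.row_sum, map_one]
  col_sum j := by rw [← map_sum, hp.col_sum, map_one]

end IsMagicUnitary

section BlockMatrix

variable {m : ℕ} {D : Type u} [CStarAlgebra D] (x : Fin (m + 1)) (p : Fin m → Fin m → D)

/-- The matrix of size `m + 1` obtained from `p` by inserting a row and a column of the identity
matrix at position `x`. -/
def blockMatrix : Fin (m + 1) → Fin (m + 1) → D :=
  x.insertNth (α := fun _ => Fin (m + 1) → D)
    (x.insertNth (α := fun _ => D) 1 0) fun i => x.insertNth (α := fun _ => D) 0 (p i)

@[simp] lemma blockMatrix_same_same : blockMatrix x p x x = 1 := by simp [blockMatrix]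

@[simp] lemma blockMatrix_same_succAbove (j : Fin m) :
    blockMatrix x p x (x.succAbove j) = 0 := by simp [blockMatrix]

@[simp] lemma blockMatrix_succAbove_same (i : Fin m) :
    blockMatrix x p (x.succAbove i) x = 0 := by simp [blockMatrix]

@[simp] lemma blockMatrix_succAbove_succAbove (i j : Fin m) :
    blockMatrix x p (x.succAbove i) (x.succAbove j) = p i j := by simp [blockMatrix]

variable {p}

lemma isMagicUnitary_blockMatrix (hp : IsMagicUnitary p) : IsMagicUnitary (blockMatrix x p) where
  star_eq i j := by
    cases i using x.succAboveCases <;> cases j using x.succAboveCases <;> simp [hp.star_eq]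
  mul_self i j := by
    cases i using x.succAboveCases <;> cases j using x.succAboveCases <;> simp [hp.mul_self]
  row_sum i := by
    cases i using x.succAboveCases <;> simp [Fin.sum_univ_succAbove _ x, hp.row_sum]
  col_sum j := by
    cases j using x.succAboveCases <;> simp [Fin.sum_univ_succAbove _ x, hp.col_sum]

end BlockMatrix

/-! ### The stabilizer of a point -/

namespace QuantumPermutationAlgebra

variable {m : ℕ} (x : Fin (m + 1))

/-- The *-homomorphism `A_s(m + 1) → A_s(m)` dual to the inclusion of the permutations fixing `x`:
it maps `a_{xx}` to `1`, the other entries of row and column `x` to `0`, and the remaining entries to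
the generators of `A_s(m)`, the indices other than `x` being enumerated by `x.succAbove`. -/
def toStabilizer : QuantumPermutationAlgebra (m + 1) →⋆ₐ[ℂ] QuantumPermutationAlgebra m :=
  lift (blockMatrix x gen) (isMagicUnitary_blockMatrix x isMagicUnitary_gen)

lemma toStabilizer_gen (i j : Fin (m + 1)) : toStabilizer x (gen i j) = blockMatrix x gen i j :=
  lift_gen _ _ i j

lemma toStabilizer_surjective : Function.Surjective (toStabilizer x) := by
  refine surjective_of_denseRange _ (dense_adjoin_gen.mono ?_)
  change _ ≤ (toStabilizer x).toAlgHom.range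
  refine Algebra.adjoin_le ?_
  rintro _ ⟨i, j, rfl⟩
  exact ⟨gen (x.succAbove i) (x.succAbove j), (toStabilizer_gen x _ _).trans (by simp)⟩

lemma map_comul_toStabilizer (a : QuantumPermutationAlgebra (m + 1)) :
    MinTensor.map (toStabilizer x) (toStabilizer x) (comul a) = comul (toStabilizer x a) := by
  have : (MinTensor.map (toStabilizer x) (toStabilizer x)).comp comul =
      comul.comp (toStabilizer x) := by
    refine (magicNorm (m + 1)).hom_ext fun w => ?_
    change MinTensor.map (toStabilizer x) (toStabilizer x) (comul (ofFree w)) =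
      comul (toStabilizer x (ofFree w))
    induction w using FreeMatrixAlgebra.induction with
    | hc c => simp only [AlgHomClass.commutes]
    | hg i j =>
      change MinTensor.map (toStabilizer x) (toStabilizer x) (comul (gen i j)) =
        comul (toStabilizer x (gen i j))
      rw [comul_gen, toStabilizer_gen, map_sum]
      simp only [MinTensor.map_tmul, toStabilizer_gen, Fin.sum_univ_succAbove _ x]
      cases i using x.succAboveCases <;> cases j using x.succAboveCases <;>
        simp [MinTensor.zero_tmul, MinTensor.tmul_zero, MinTensor.tmul_one_one, comul_gen]
    | ha a b ha hb => simp only [map_add, ha, hb]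
    | hm a b ha hb => simp only [map_mul, ha, hb]
  exact congr($this a)

end QuantumPermutationAlgebra

/-- `A_s(m)` as the quantum subgroup of `A_s(m + 1)` fixing the point `x`. -/
def pointStabilizer {m : ℕ} (x : Fin (m + 1)) :
    QuantumSubgroup (quantumPermutationGroup (m + 1)) where
  grp := quantumPermutationGroup m
  π := QuantumPermutationAlgebra.toStabilizer x
  surjective := QuantumPermutationAlgebra.toStabilizer_surjective x
  isMorphism := QuantumPermutationAlgebra.map_comul_toStabilizer x

namespace QuantumSubgroup

open QuantumPermutationAlgebra

section Factor

variable {G : CompactQuantumGroup} {H K : QuantumSubgroup G}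
  {θ : H.grp.carrier →⋆ₐ[ℂ] K.grp.carrier}

lemma surjective_of_comp_eq (hθ : ∀ a, θ (H.π a) = K.π a) : Function.Surjective θ :=
  Function.Surjective.of_comp (g := H.π) fun b => (K.surjective b).imp fun a ha => (hθ a).trans ha

lemma isMorphism_of_comp_eq (hθ : ∀ a, θ (H.π a) = K.π a) : H.grp.IsMorphism K.grp θ := fun b => by
  have h : θ.comp H.π = K.π := StarAlgHom.ext hθ
  obtain ⟨a, rfl⟩ := H.surjective b
  rw [← H.isMorphism, MinTensor.map_map, h, K.isMorphism, hθ]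

end Factor

/-- A quantum subgroup fixes `x` as soon as the entry `a_{xx}` becomes `1` in it: the other entries
of row `x` are orthogonal to it, hence become `0`. -/
lemma fixes_singleton_iff {n : ℕ} (H : QuantumSubgroup (quantumPermutationGroup n))
    {α : QuantumAction (quantumPermutationGroup n) (Fin n)}
    (hα : ∀ i : Fin n, α.toHom (pointFunction i) =
      ∑ j : Fin n, MinTensor.tmul (pointFunction j) (quantumPermutationGroup.gen j i))
    (x : Fin n) : H.Fixes α {x} ↔ H.π (quantumPermutationGroup.gen x x) = 1 := by
  have hp : IsMagicUnitary fun i j => H.π (quantumPermutationGroup.gen i j) :=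
    isMagicUnitary_gen.map H.π
  have heval : ∀ i, MinTensor.map (ContinuousMap.evalStarAlgHom ℂ ℂ x)
      (StarAlgHom.id ℂ H.grp.carrier) (H.restrict α (pointFunction i)) =
      MinTensor.tmul 1 (H.π (quantumPermutationGroup.gen x i)) := fun i => by
    change MinTensor.map _ _ (MinTensor.map _ _ (α.toHom (pointFunction i))) = _
    rw [hα, MinTensor.map_map, map_sum, Finset.sum_eq_single x]
    · simp [pointFunction_apply]
    · intro j _ hj
      simp [pointFunction_apply, hj.symm, MinTensor.zero_tmul]
    · simp
  constructor
  · intro h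
    have h' := h (pointFunction x) x rfl
    rw [heval, ← sub_eq_zero] at h'
    rw [← MinTensor.inr_apply, ← MinTensor.inr_apply, ← map_sub, MinTensor.inr_apply,
      MinTensor.tmul_eq_zero, sub_eq_zero] at h'
    simpa [pointFunction_apply] using h'
  · rintro h f y rfl
    conv_lhs => rw [eq_sum_pointFunction f]
    simp only [map_sum, map_smul, heval]
    rw [Finset.sum_eq_single y]
    · rw [h, Algebra.algebraMap_eq_smul_one, MinTensor.tmul_smul]
    · intro i _ hi
      rw [hp.apply_eq_zero_of_row_eq_one h hi, MinTensor.tmul_zero, smul_zero]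
    · simp

lemma isStabilizer_pointStabilizer {m : ℕ}
    {α : QuantumAction (quantumPermutationGroup (m + 1)) (Fin (m + 1))}
    (hα : ∀ i, α.toHom (pointFunction i) =
      ∑ j, MinTensor.tmul (pointFunction j) (quantumPermutationGroup.gen j i))
    (x : Fin (m + 1)) : (pointStabilizer x).IsStabilizer α {x} := by
  refine ⟨(fixes_singleton_iff _ hα x).2 ?_, fun K hK => ?_⟩
  · exact (toStabilizer_gen x x x).trans (blockMatrix_same_same x _)
  rw [fixes_singleton_iff K hα] at hK
  have hp : IsMagicUnitary fun i j => K.π (quantumPermutationGroup.gen i j) :=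
    isMagicUnitary_gen.map K.π
  let θ : QuantumPermutationAlgebra m →⋆ₐ[ℂ] K.grp.carrier := lift _ (hp.submatrix_succAbove hK)
  have hθ : θ.comp (toStabilizer x) = K.π := by
    refine hom_ext fun i j => ?_
    rw [StarAlgHom.comp_apply, toStabilizer_gen]
    change _ = K.π (quantumPermutationGroup.gen i j)
    cases i using x.succAboveCases with
    | x =>
      cases j using x.succAboveCases with
      | x => rw [blockMatrix_same_same, map_one, hK]
      | p j =>
        rw [blockMatrix_same_succAbove, map_zero]
        exact (hp.apply_eq_zero_of_row_eq_one hK (x.succAbove_ne j)).symm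
    | p i =>
      cases j using x.succAboveCases with
      | x =>
        rw [blockMatrix_succAbove_same, map_zero]
        exact (hp.apply_eq_zero_of_col_eq_one hK (x.succAbove_ne i)).symm
      | p j => rw [blockMatrix_succAbove_succAbove, lift_gen]
  have hθ' : ∀ a, θ ((pointStabilizer x).π a) = K.π a := fun a => congr($hθ a)
  exact ⟨θ, surjective_of_comp_eq hθ', isMorphism_of_comp_eq hθ', hθ'⟩

/-- Two stabilizers factor through each other, and the two factorizations are mutually inverse since
`H.π` and `K.π` are surjective. -/
lemma IsStabilizer.isIsomorphic {G : CompactQuantumGroup} {X : Type} [TopologicalSpace X]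
    [CompactSpace X] [T2Space X] {α : QuantumAction G X} {Y : Set X} {H K : QuantumSubgroup G}
    (hH : H.IsStabilizer α Y) (hK : K.IsStabilizer α Y) : H.grp.IsIsomorphic K.grp := by
  obtain ⟨θ, -, hθ, hθπ⟩ := hH.2 K hK.1
  obtain ⟨η, -, -, hηπ⟩ := hK.2 H hH.1
  refine ⟨StarAlgEquiv.ofStarAlgHom θ η ?_ ?_, hθ⟩
  · ext b
    obtain ⟨a, rfl⟩ := H.surjective b
    simp [hθπ, hηπ]
  · ext b
    obtain ⟨a, rfl⟩ := K.surjective b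
    simp [hθπ, hηπ]

end QuantumSubgroup

end

theorem mainTheorem2 (n : ℕ) (α : QuantumAction (quantumPermutationGroup n) (Fin n))
    (hα : ∀ i : Fin n, α.toHom (pointFunction i) =
      ∑ j : Fin n, MinTensor.tmul (pointFunction j) (quantumPermutationGroup.gen j i))
    (x : Fin n) :
    (∃ H : QuantumSubgroup (quantumPermutationGroup n), H.IsStabilizer α {x}) ∧
      ∀ H : QuantumSubgroup (quantumPermutationGroup n), H.IsStabilizer α {x} →
        H.grp.IsIsomorphic (quantumPermutationGroup (n - 1)) := by
  obtain _ | m := n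
  · exact x.elim0
  have h := QuantumSubgroup.isStabilizer_pointStabilizer hα x
  exact ⟨⟨_, h⟩, fun H hH => hH.isIsomorphic h⟩
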